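/- **Model.** There are $l$ primaries and $m$ secondaries at each node of a finite conflict graph $G=(V,E)$, with $1\le m<l$. The channel of a primary has at each node a state in $\{0,1,\dots,n\}$, where state $0$ means that it cannot be sold there. The state vectors $J\in\{0,\dots,n\}^V$ of the primaries are independent, each equal to $J$ with probability $q_J$, and $q_{(0,\dots,0)}>0$. Prices range over an interval $D\subseteq\mathbb R$ (for example $\mathbb R$ or $[0,\infty)$) containing the transition cost $c$. In state $j\ge1$ the price $p$ gives penalty $g_j(p)$, where $g_j:D\to\mathbb R$ is continuous and strictly increasing with inverse $f_j$, and $g_j(p)<g_i(p)$ for $i<j$. The cap $v$ satisfies $v\in g_j(D)$ and $v>g_j(c)$ for $1\le j\le n$. Moreover, for $1\le i<j\le n$, $$\frac{f_i(y)-c}{f_j(y)-c}<\frac{f_i(x)-c}{f_j(x)-c}\qquad\text{for all } x>y>g_i(c)\ \text{ with } x\in g_i(D)\cap g_j(D).$$ A strategy of a primary prescribes, for each $J$, a probability mass function $\beta_J$ on the independent sets of $G$ contained in $\{a: J_a\neq0\}$, and for each node $a$ a probability distribution $\psi_{J,a}$ of the penalty quoted at $a$ when $a$ is in the selected set. (If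 $J_a=j\ge 1$, then $\psi_{J,a}$ is carried by $g_j(D)$ and $f_j$ is $\psi_{J,a}$-integrable on $(-\infty,v]$.) The random choices of different primaries are independent. At each node the (at most $m$) lowest offered penalties not exceeding $v$ are sold, with ties broken uniformly at random. A primary quoting penalty $x$ at a node in state $j$ gains $f_j(x)-c$ if it sells there and $0$ otherwise, and its payoff is the sum of its gains over the selected independent set. A symmetric Nash equilibrium (NE) is a strategy used by all primaries such that, for every $J$ with $q_J>0$, no primary can increase its expected payoff at $J$ by a unilateral deviation. **Single-location distributions.** Let $w(x)=\sum_{i=m}^{l-1}\binom{l-1}{i}x^i(1-x)^{l-1-i}$, with inverse $w^{-1}$ on $[0,1]$. For $\alpha=(\alpha_1,\dots,\alpha_n)$ put $L_0=v$ and, for $1\le j\le n$, $$p_j-c=(f_j(L_{j-1})-c)\Bigl(1-w\bigl(\textstyle\sum_{k=j}^n\alpha_k\bigr)\Bigr),\qquad L_j=g_j\Bigl(\frac{p_j-c}{1-w(\sum_{k=j+1}^n\alpha_k)}+c\Bigr),$$ and, if $\alpha_j>0$, $$\phi_j(x)=\begin{cases}0,& x<L_j,\\ \dfrac1{\alpha_j}\Bigl(w^{-1}\Bigl(\dfrac{f_j(x)-p_j}{f_j(x)-c}\Bigr)-\sum_{k=j+1}^n\alpha_k\Bigr),&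 L_j\le x\le L_{j-1},\\ 1,& x>L_{j-1}.\end{cases}$$ **Lemma.** Given a symmetric NE, let $$\alpha_{a,j}=\sum_{J:\,J_a=j}\ \sum_{I\ni a}q_J\,\beta_J(I)$$ be the probability that a primary has state $j$ at node $a$ and offers its channel there. Let $a\in V$ and $1\le j\le n$ with $\alpha_{a,j}>0$. Then the penalty distribution of each primary at node $a$ in state $j$, that is, the conditional distribution of its penalty at $a$ given that its channel has state $j$ at $a$ and is offered there, has distribution function $\phi_j$ with $(\alpha_k)_k=(\alpha_{a,k})_k$. In particular, if the strategy uses one and the same law $\nu$ at $a$ for all $J$ with $J_a=j$, $q_J>0$ and $\sum_{I\ni a}\beta_J(I)>0$, then $\nu$ has distribution function $\phi_j$. -/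

import Mathlib

open MeasureTheory Set

noncomputable section

/-- The market: `l` primaries, `m` secondaries per node with `1 ≤ m < l`, channel states `0, …, n`
(state `0` means "not available"), a conflict graph `G` on a finite set of nodes, and
* the interval `prices` of admissible prices, the transition cost `c`, the penalty cap `v`;
* `g j`, the penalty as a function of the price in state `j` (only `1 ≤ j ≤ n` matters);
* `q J`, the probability that the channel state vector of a primary is `J`. -/
structure SpectrumMarket (V : Type*) [Fintype V] [DecidableEq V] where
  l : ℕ
  m : ℕ
  n : ℕ
  one_le_m : 1 ≤ m
  m_lt_l : m < l
  G : SimpleGraph V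
  prices : Set ℝ
  ordConnected_prices : prices.OrdConnected
  c : ℝ
  c_mem : c ∈ prices
  v : ℝ
  g : ℕ → ℝ → ℝ
  g_strictMono : ∀ j, 1 ≤ j → j ≤ n → StrictMonoOn (g j) prices
  g_continuous : ∀ j, 1 ≤ j → j ≤ n → ContinuousOn (g j) prices
  /-- For a given price, a better state has a lower penalty. -/
  g_lt : ∀ i j, 1 ≤ i → i < j → j ≤ n → ∀ p ∈ prices, g j p < g i p
  /-- The cap `v` is an attainable penalty in every state, at a price above the cost. -/
  v_mem : ∀ j, 1 ≤ j → j ≤ n → v ∈ g j '' prices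
  g_c_lt_v : ∀ j, 1 ≤ j → j ≤ n → g j c < v
  /-- With `f j` the inverse of `g j`: `(f i y - c) / (f j y - c) < (f i x - c) / (f j x - c)` for
  all attainable penalties `x > y > g i c` and all states `i < j`. -/
  ratio_lt : ∀ i j, 1 ≤ i → i < j → j ≤ n → ∀ x y, g i c < y → y < x →
    x ∈ g i '' prices → x ∈ g j '' prices →
    (Function.invFunOn (g i) prices y - c) / (Function.invFunOn (g j) prices y - c) <
      (Function.invFunOn (g i) prices x - c) / (Function.invFunOn (g j) prices x - c)
  q : (V → Fin (n + 1)) → ℝ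
  q_nonneg : ∀ J, 0 ≤ q J
  q_sum : ∑ J, q J = 1
  q_zero_pos : 0 < q (fun _ => 0)

namespace SpectrumMarket

variable {V : Type*} [Fintype V] [DecidableEq V] (M : SpectrumMarket V)

/-- The inverse penalty function: `M.f j x` is the price whose penalty in state `j` is `x`. -/
def f (j : ℕ) (x : ℝ) : ℝ := Function.invFunOn (M.g j) M.prices x

/-! ### Strategies -/

/-- `I` is an independent set of the graph `G_J` induced by `G` on the nodes where the channel is
available. -/
def IsIndepSetAt (J : V → Fin (M.n + 1)) (I : Finset V) : Prop :=
  (∀ a ∈ I, J a ≠ 0) ∧ M.G.IsIndepSet (I : Set V)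

/-- A strategy `ψ_J` at the channel state vector `J`: a probability mass function on the
independent sets of `G_J`, and for each node a probability distribution of the penalty quoted
there. At a node in state `j ≥ 1` it quotes penalties of admissible prices, and the price has a
finite expectation over the penalties `≤ v`, the ones at which a sale is possible. -/
structure StrategyAt (J : V → Fin (M.n + 1)) where
  select : Finset V → ℝ
  select_nonneg : ∀ I, 0 ≤ select I
  select_sum : ∑ I, select I = 1
  select_indep : ∀ I, select I ≠ 0 → M.IsIndepSetAt J I
  penalty : V → Measure ℝ
  penalty_prob : ∀ a, IsProbabilityMeasure (penalty a)
  penalty_mem : ∀ a, J a ≠ 0 → ∀ᵐ x ∂(penalty a), x ∈ M.g (J a) '' M.prices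
  penalty_integrable : ∀ a, J a ≠ 0 → IntegrableOn (M.f (J a)) (Iic M.v) (penalty a)

/-- A strategy of a primary: a `StrategyAt J` for every channel state vector `J`. (At `J = 0` the
only independent set is `∅`, so nothing is offered.) -/
def Strategy : Type _ := ∀ J : V → Fin (M.n + 1), M.StrategyAt J

variable {M}

/-- The probability that `ψ` offers the channel at node `a`. -/
def StrategyAt.offerProb {J : V → Fin (M.n + 1)} (ψ : M.StrategyAt J) (a : V) : ℝ :=
  ∑ I with a ∈ I, ψ.select I

variable (M)

/-! ### Payoffs and equilibrium -/

/-- The law of what a primary with strategy `S` quotes at node `a`: a penalty, or `⊤` if it does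
not offer its channel at `a`. -/
def offerLaw (S : M.Strategy) (a : V) : Measure EReal :=
  ∑ J, ∑ I : Finset V, ENNReal.ofReal (M.q J * (S J).select I) •
    (if a ∈ I then ((S J).penalty a).map Real.toEReal else Measure.dirac ⊤)

/-- The probability that a channel of penalty `x` is sold, given the quotes `y` of the competitors
at the node: the `m` lowest penalties are sold, none above `v`, and ties are broken uniformly. -/
def saleProb {ι : Type*} [Fintype ι] (x : ℝ) (y : ι → EReal) : ℝ :=
  open Classical in
  if x ≤ M.v then
    min 1 (((M.m - (Finset.univ.filter fun k => y k < (x : EReal)).card : ℕ) : ℝ) /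
      (((Finset.univ.filter fun k => y k = (x : EReal)).card : ℝ) + 1))
  else 0

/-- The probability that primary `i` sells at node `a` at penalty `x`, when the other primaries
play according to `S`, with independent channel states and independent randomization. -/
def winProb (S : Fin M.l → M.Strategy) (i : Fin M.l) (a : V) (x : ℝ) : ℝ :=
  ∫ y, M.saleProb x y ∂(Measure.pi fun k : {k : Fin M.l // k ≠ i} => M.offerLaw (S k) a)

/-- The expected payoff `u_{i,J}(ψ, S_{-i})`; it does not involve `S i`. -/
def payoff (S : Fin M.l → M.Strategy) (i : Fin M.l) (J : V → Fin (M.n + 1))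
    (ψ : M.StrategyAt J) : ℝ :=
  ∑ I, ψ.select I *
    ∑ a ∈ I, ∫ x, (M.f (J a) x - M.c) * M.winProb S i a x ∂(ψ.penalty a)

/-- Nash equilibrium: no primary gains by a unilateral deviation, at any channel state vector that
can occur. -/
def IsNash (S : Fin M.l → M.Strategy) : Prop :=
  ∀ (i : Fin M.l) (J : V → Fin (M.n + 1)), 0 < M.q J →
    ∀ ψ : M.StrategyAt J, M.payoff S i J ψ ≤ M.payoff S i J (S i J)

/-- Symmetric Nash equilibrium: all primaries use the same strategy. -/
def IsSymmetricNash (S : Fin M.l → M.Strategy) : Prop :=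
  M.IsNash S ∧ ∀ i k, S i = S k

/-! ### Node selection probabilities and penalty distributions -/

/-- `α_{a,j}`: the probability that a primary with strategy `S` has state `j` at node `a` and
offers its channel there. -/
def nodeProb (S : M.Strategy) (a : V) (j : ℕ) : ℝ :=
  ∑ J with (J a : ℕ) = j, M.q J * (S J).offerProb a

/-- The penalty distribution at node `a` in state `j`: the conditional law of the penalty that a
primary with strategy `S` quotes at `a`, given that its channel has state `j` at `a` and is offered
there (meaningful if `M.nodeProb S a j > 0`). -/
def penaltyLaw (S : M.Strategy) (a : V) (j : ℕ) : Measure ℝ :=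
  ENNReal.ofReal (M.nodeProb S a j)⁻¹ •
    ∑ J with (J a : ℕ) = j, ENNReal.ofReal (M.q J * (S J).offerProb a) • (S J).penalty a

/-! ### The single-location distributions -/

/-- The probability of at least `m` successes in `l - 1` independent trials of success
probability `x`. -/
def w (x : ℝ) : ℝ :=
  ∑ i ∈ Finset.Icc M.m (M.l - 1),
    ((M.l - 1).choose i : ℝ) * x ^ i * (1 - x) ^ (M.l - 1 - i)

/-- The inverse of `w` on `[0, 1]`. -/
def wInv (y : ℝ) : ℝ := Function.invFunOn M.w (Icc 0 1) y

/-- `∑_{k = j}^{n} α_k`. -/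
def tailSum (α : ℕ → ℝ) (j : ℕ) : ℝ := ∑ k ∈ Finset.Icc j M.n, α k

/-- `(f_j(U) - c) (1 - w (∑_{k = j}^{n} α_k))`. -/
def profit (α : ℕ → ℝ) (j : ℕ) (U : ℝ) : ℝ :=
  (M.f j U - M.c) * (1 - M.w (M.tailSum α j))

/-- The endpoints: `L_0 = v` and
`L_j = g_j ((p_j - c) / (1 - w (∑_{k = j + 1}^{n} α_k)) + c)`, where
`p_j - c = (f_j(L_{j-1}) - c) (1 - w (∑_{k = j}^{n} α_k))`. -/
def L (α : ℕ → ℝ) : ℕ → ℝ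
  | 0 => M.v
  | j + 1 => M.g (j + 1)
      (M.profit α (j + 1) (L α j) / (1 - M.w (M.tailSum α (j + 2))) + M.c)

/-- `p_j = c + (f_j(L_{j-1}) - c) (1 - w (∑_{k = j}^{n} α_k))`, for `j ≥ 1`. -/
def p (α : ℕ → ℝ) (j : ℕ) : ℝ := M.c + M.profit α j (M.L α (j - 1))

/-- The single-location distribution function `φ_j`, for `j ≥ 1`, when `α_k` is the probability
that the channel of a primary is in state `k`. -/
def phi (α : ℕ → ℝ) (j : ℕ) (x : ℝ) : ℝ :=
  if x < M.L α j then 0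
  else if x ≤ M.L α (j - 1) then
    1 / α j * (M.wInv ((M.f j x - M.p α j) / (M.f j x - M.c)) - M.tailSum α (j + 1))
  else 1

end SpectrumMarket

end

namespace SpectrumMarket

variable {V : Type*} [Fintype V] [DecidableEq V] (M : SpectrumMarket V)

/-! ### The binomial tail `w` -/

/-! Fix a node `a` and let F be the distribution function `quoteCdf` of a quote there. Payoffs are
sums over nodes, so at every state vector a primary's quote at `a` must almost surely maximize its
gain at `a` (`IsSymmetricNash.exists_max`). An atom of F would invite undercutting, since a tie of
all primaries is sometimes lost (`IsSymmetricNash.offerLaw_real_singleton`). So F is continuous, and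
a penalty x ≤ v wins with probability exactly 1 - w(F(x)).

Two arguments then locate the sets of best penalties. Ordering: the ratio condition on the inverse
penalty functions forces every best penalty of a better state to be at most every best penalty of a
worse one (`le_of_mem_bestPenalties`). No gaps: raising the penalty while F stays constant cannot
lower the gain, so optimality carries over to the right end of an interval where F is flat
(`mem_bestPenalties_of_quoteCdf_eq`).

Induction on the state, downwards from v, shows that L_j separates the penalties of states k > j
from those of states k ≤ j (`IsSymmetricNash.separates_L`). If α_j > 0, then L_{j-1} is a best
penalty for state j and L_j is the least one. Their gains agree, while F takes there the values
given by the tail sums of α, and this equation is the recursion for L_j. If α_j = 0, the endpoints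
coincide. On [L_j, L_{j-1}] only state j adds to F, every penalty is optimal, and the constant gain
p_j - c = (f_j(x) - c)(1 - w(F(x))) is solved for F, hence for φ_j. -/

theorem derivative_sum_bernsteinPolynomial (K r d : ℕ) :
    Polynomial.derivative
        (∑ i ∈ Finset.range (d + 1), bernsteinPolynomial ℝ (K + 1) (r + 1 + i)) =
      (K + 1) * (bernsteinPolynomial ℝ K r - bernsteinPolynomial ℝ K (r + 1 + d)) := by
  induction d with
  | zero =>
    simp [bernsteinPolynomial.derivative_succ]
  | succ d ih =>
    rw [Finset.sum_range_succ, map_add, ih, show r + 1 + (d + 1) = (r + 1 + d) + 1 by ring,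
      bernsteinPolynomial.derivative_succ]
    push_cast
    ring

theorem w_eq_eval (x : ℝ) :
    M.w x = (∑ i ∈ Finset.range (M.l - 1 - M.m + 1),
      bernsteinPolynomial ℝ (M.l - 1) (M.m + i)).eval x := by
  have h1 := M.m_lt_l
  rw [Polynomial.eval_finsetSum, w, ← Finset.Ico_succ_right_eq_Icc,
    Finset.sum_Ico_eq_sum_range]
  have : Order.succ (M.l - 1) - M.m = M.l - 1 - M.m + 1 := by
    rw [Nat.succ_eq_succ]; omega
  rw [this]
  simp [bernsteinPolynomial]

theorem continuous_w : Continuous M.w := by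
  have : M.w = fun x => (∑ i ∈ Finset.range (M.l - 1 - M.m + 1),
      bernsteinPolynomial ℝ (M.l - 1) (M.m + i)).eval x := funext M.w_eq_eval
  rw [this]
  exact Polynomial.continuous _

/-- The derivatives of the Bernstein polynomials telescope: with m = r + 1 and l - 1 = K + 1, only
(K + 1) times the polynomial of index r and degree K survives, and it is positive on (0, 1). -/
theorem strictMonoOn_w : StrictMonoOn M.w (Icc 0 1) := by
  refine strictMonoOn_of_deriv_pos (convex_Icc 0 1) M.continuous_w.continuousOn fun x hx => ?_
  rw [interior_Icc] at hx
  have h1 := M.one_le_m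
  have h2 := M.m_lt_l
  obtain ⟨r, hr⟩ : ∃ r, M.m = r + 1 := ⟨M.m - 1, by omega⟩
  obtain ⟨K, hK⟩ : ∃ K, M.l - 1 = K + 1 := ⟨M.l - 2, by omega⟩
  have hfun : M.w = fun x => (∑ i ∈ Finset.range (K - r + 1),
      bernsteinPolynomial ℝ (K + 1) (r + 1 + i)).eval x := by
    funext x
    rw [M.w_eq_eval, hK, hr, show K + 1 - (r + 1) = K - r by omega]
  rw [hfun, Polynomial.deriv, derivative_sum_bernsteinPolynomial,
    bernsteinPolynomial.eq_zero_of_lt ℝ (show K < r + 1 + (K - r) by omega)]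
  have hc : 0 < ((K.choose r : ℕ) : ℝ) := by
    exact_mod_cast Nat.choose_pos (show r ≤ K by omega)
  have hx0 : 0 < x := hx.1
  have hx1 : 0 < 1 - x := by linarith [hx.2]
  simp only [bernsteinPolynomial, sub_zero, Polynomial.eval_mul, Polynomial.eval_add,
    Polynomial.eval_natCast, Polynomial.eval_one, Polynomial.eval_pow, Polynomial.eval_X,
    Polynomial.eval_sub]
  positivity

theorem w_one : M.w 1 = 1 := by
  have h2 := M.m_lt_l
  rw [w, Finset.sum_eq_single (M.l - 1)]
  · simp
  · intro i hi hne
    have : M.l - 1 - i ≠ 0 := by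
      have := (Finset.mem_Icc.1 hi).2
      omega
    simp [this]
  · intro h
    exact absurd (Finset.mem_Icc.2 ⟨by omega, le_rfl⟩) h

theorem w_lt_one {x : ℝ} (h0 : 0 ≤ x) (h1 : x < 1) : M.w x < 1 := by
  rw [← M.w_one]
  exact M.strictMonoOn_w ⟨h0, h1.le⟩ ⟨zero_le_one, le_rfl⟩ h1

theorem wInv_w {x : ℝ} (hx : x ∈ Icc (0 : ℝ) 1) : M.wInv (M.w x) = x :=
  M.strictMonoOn_w.injOn.leftInvOn_invFunOn hx

/-! ### Numbers of independent quotes in a given set -/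

section Count

variable {ι X : Type*} [Fintype ι]

open Classical in
-- Exhibits the event as a box, so that the product measure factors over the indices.
theorem setOf_filter_mem_eq (s : Set X) (A : Finset ι) :
    {y : ι → X | (Finset.univ.filter fun k => y k ∈ s) = A} =
      Set.univ.pi fun k => if k ∈ A then s else sᶜ := by
  ext y
  simp only [Set.mem_ofPred_eq, Finset.ext_iff, Finset.mem_filter, Finset.mem_univ, true_and,
    Set.mem_pi, Set.mem_univ, forall_const]
  refine forall_congr' fun k => ?_
  by_cases hk : k ∈ A <;> simp [hk]

variable [MeasurableSpace X]

open Classical in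
theorem measurable_card_filter {s : Set X} (hs : MeasurableSet s) :
    Measurable fun y : ι → X => (Finset.univ.filter fun k => y k ∈ s).card := by
  simp only [Finset.card_filter]
  refine Finset.measurable_sum _ fun k _ => Measurable.ite ?_ measurable_const measurable_const
  exact measurable_pi_apply k hs

open Classical in
theorem pi_real_filter_eq (μ : Measure X) [IsProbabilityMeasure μ] {s : Set X}
    (hs : MeasurableSet s) (A : Finset ι) :
    (Measure.pi fun _ : ι => μ).real {y | (Finset.univ.filter fun k => y k ∈ s) = A} =
      μ.real s ^ A.card * (1 - μ.real s) ^ (Fintype.card ι - A.card) := by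
  rw [setOf_filter_mem_eq, measureReal_def, Measure.pi_pi, ENNReal.toReal_prod]
  have : ∀ k, (μ (if k ∈ A then s else sᶜ)).toReal =
      if k ∈ A then μ.real s else 1 - μ.real s := by
    intro k
    split_ifs
    · rfl
    · exact probReal_compl_eq_one_sub hs
  simp only [this]
  rw [Finset.prod_ite]
  simp only [Finset.prod_const]
  congr 2
  · congr 1; ext; simp
  · rw [← Finset.card_compl]
    congr 1; ext; simp

open Classical in
-- The event splits disjointly according to the exact set `A` of indices landing in `s`; grouping
-- the sets `A` by cardinality gives the binomial tail.
theorem pi_real_le_card_filter (μ : Measure X) [IsProbabilityMeasure μ] {s : Set X}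
    (hs : MeasurableSet s) (r : ℕ) :
    (Measure.pi fun _ : ι => μ).real {y | r ≤ (Finset.univ.filter fun k => y k ∈ s).card} =
      ∑ i ∈ Finset.Icc r (Fintype.card ι),
        ((Fintype.card ι).choose i : ℝ) * μ.real s ^ i *
          (1 - μ.real s) ^ (Fintype.card ι - i) := by
  have h : {y : ι → X | r ≤ (Finset.univ.filter fun k => y k ∈ s).card} =
      ⋃ A ∈ (Finset.univ.filter fun A : Finset ι => r ≤ A.card),
        {y | (Finset.univ.filter fun k => y k ∈ s) = A} := by
    ext y
    simp
  rw [h, measureReal_biUnion_finset]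
  · simp only [pi_real_filter_eq μ hs]
    rw [Finset.sum_filter, ← Finset.powerset_univ,
      Finset.sum_powerset_apply_card (fun i => if r ≤ i then μ.real s ^ i *
        (1 - μ.real s) ^ (Fintype.card ι - i) else 0), Finset.card_univ]
    simp only [smul_ite, smul_zero]
    rw [← Finset.sum_filter]
    refine Finset.sum_congr ?_ fun i _ => by simp [mul_assoc]
    ext i
    simp only [Finset.mem_filter, Finset.mem_range, Finset.mem_Icc]
    omega
  · intro A _ B _ hAB
    refine Set.disjoint_left.2 fun y hA hB => hAB ?_
    exact hA.symm.trans hB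
  · intro A _
    rw [setOf_filter_mem_eq]
    refine MeasurableSet.univ_pi fun k => ?_
    split_ifs
    exacts [hs, hs.compl]

end Count

end SpectrumMarket

namespace SpectrumMarket

variable {V : Type*} [Fintype V] [DecidableEq V] (M : SpectrumMarket V)

/-! ### The law of a quote -/

theorem StrategyAt.offerProb_nonneg {M : SpectrumMarket V} {J : V → Fin (M.n + 1)}
    (ψ : M.StrategyAt J) (a : V) : 0 ≤ ψ.offerProb a :=
  Finset.sum_nonneg fun I _ => ψ.select_nonneg I

theorem StrategyAt.offerProb_le_one {M : SpectrumMarket V} {J : V → Fin (M.n + 1)}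
    (ψ : M.StrategyAt J) (a : V) : ψ.offerProb a ≤ 1 := by
  rw [← ψ.select_sum]
  exact Finset.sum_le_sum_of_subset_of_nonneg (Finset.filter_subset _ _)
    fun I _ _ => ψ.select_nonneg I

theorem StrategyAt.offerProb_eq_zero {M : SpectrumMarket V} {J : V → Fin (M.n + 1)}
    (ψ : M.StrategyAt J) {a : V} (h : J a = 0) : ψ.offerProb a = 0 := by
  refine Finset.sum_eq_zero fun I hI => ?_
  by_contra hne
  exact (ψ.select_indep I hne).1 a (Finset.mem_filter.1 hI).2 h

variable (S : M.Strategy) (a : V)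

theorem isProbabilityMeasure_offerLaw : IsProbabilityMeasure (M.offerLaw S a) := by
  constructor
  have h : ∀ J (I : Finset V), (if a ∈ I then ((S J).penalty a).map Real.toEReal
      else Measure.dirac ⊤) Set.univ = 1 := by
    intro J I
    split_ifs
    · have := (S J).penalty_prob a
      rw [Measure.map_apply measurable_coe_real_ereal MeasurableSet.univ, preimage_univ,
        measure_univ]
    · simp
  simp only [offerLaw, Measure.finsetSum_apply, Measure.smul_apply, smul_eq_mul, h, mul_one]
  have h2 : ∀ J, ∑ I, ENNReal.ofReal (M.q J * (S J).select I) = ENNReal.ofReal (M.q J) := by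
    intro J
    rw [← ENNReal.ofReal_sum_of_nonneg fun I _ =>
      mul_nonneg (M.q_nonneg J) ((S J).select_nonneg I), ← Finset.mul_sum, (S J).select_sum,
      mul_one]
  simp only [h2]
  rw [← ENNReal.ofReal_sum_of_nonneg fun J _ => M.q_nonneg J, M.q_sum, ENNReal.ofReal_one]

theorem offerLaw_real {s : Set EReal} (hs : MeasurableSet s) (ht : ⊤ ∉ s) :
    (M.offerLaw S a).real s =
      ∑ J, M.q J * (S J).offerProb a * ((S J).penalty a).real (Real.toEReal ⁻¹' s) := by
  have h : ∀ J (I : Finset V), ENNReal.ofReal (M.q J * (S J).select I) *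
      (if a ∈ I then ((S J).penalty a).map Real.toEReal else Measure.dirac ⊤) s =
      ENNReal.ofReal (M.q J * (if a ∈ I then (S J).select I else 0) *
        ((S J).penalty a).real (Real.toEReal ⁻¹' s)) := by
    intro J I
    have := (S J).penalty_prob a
    split_ifs
    · rw [Measure.map_apply measurable_coe_real_ereal hs, ENNReal.ofReal_mul
        (mul_nonneg (M.q_nonneg J) ((S J).select_nonneg I)), ofReal_measureReal]
    · simp [hs, ht]
  have h0 : ∀ J (I : Finset V), 0 ≤ M.q J * (if a ∈ I then (S J).select I else 0) *
        ((S J).penalty a).real (Real.toEReal ⁻¹' s) := by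
    intro J I
    refine mul_nonneg (mul_nonneg (M.q_nonneg J) ?_) measureReal_nonneg
    split_ifs
    exacts [(S J).select_nonneg I, le_rfl]
  simp only [offerLaw, measureReal_def, Measure.finsetSum_apply, Measure.smul_apply, smul_eq_mul]
  simp only [h]
  simp only [← ENNReal.ofReal_sum_of_nonneg fun I _ => h0 _ I]
  rw [← ENNReal.ofReal_sum_of_nonneg fun J _ => Finset.sum_nonneg fun I _ => h0 J I,
    ENNReal.toReal_ofReal (Finset.sum_nonneg fun J _ => Finset.sum_nonneg fun I _ => h0 J I)]
  refine Finset.sum_congr rfl fun J _ => ?_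
  rw [← Finset.sum_mul, ← Finset.mul_sum, StrategyAt.offerProb, Finset.sum_filter,
    measureReal_def]

theorem nodeProb_nonneg (j : ℕ) : 0 ≤ M.nodeProb S a j :=
  Finset.sum_nonneg fun J _ => mul_nonneg (M.q_nonneg J) ((S J).offerProb_nonneg a)

/-- Strict because with positive probability the channel is available nowhere. This is what keeps 1
- w positive at all relevant arguments. -/
theorem sum_nodeProb_lt_one : ∑ k ∈ Finset.Icc 1 M.n, M.nodeProb S a k < 1 := by
  have h1 : ∑ k ∈ Finset.Icc 1 M.n, M.nodeProb S a k ≤ ∑ J, M.q J * (S J).offerProb a := by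
    simp only [nodeProb]
    rw [← Finset.sum_fiberwise_of_maps_to (s := Finset.univ) (t := Finset.range (M.n + 1))
      (g := fun J : V → Fin (M.n + 1) => (J a : ℕ)) fun J _ =>
        Finset.mem_range.2 (J a).is_lt]
    refine Finset.sum_le_sum_of_subset_of_nonneg (fun k hk => ?_) fun k _ _ =>
      M.nodeProb_nonneg S a k
    simp only [Finset.mem_Icc] at hk
    simp only [Finset.mem_range]
    omega
  refine h1.trans_lt ?_
  rw [← M.q_sum]
  refine Finset.sum_lt_sum (fun J _ => mul_le_of_le_one_right (M.q_nonneg J)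
    ((S J).offerProb_le_one a)) ⟨fun _ => 0, Finset.mem_univ _, ?_⟩
  rw [(S fun _ => 0).offerProb_eq_zero rfl, mul_zero]
  exact M.q_zero_pos

variable {M S a}

theorem penaltyLaw_real (s : Set ℝ) (j : ℕ) :
    (M.penaltyLaw S a j).real s = (M.nodeProb S a j)⁻¹ *
      ∑ J with (J a : ℕ) = j, M.q J * (S J).offerProb a * ((S J).penalty a).real s := by
  have h0 : ∀ J, 0 ≤ M.q J * (S J).offerProb a := fun J =>
    mul_nonneg (M.q_nonneg J) ((S J).offerProb_nonneg a)
  have h : ∀ J, ENNReal.ofReal (M.q J * (S J).offerProb a) * (S J).penalty a s =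
      ENNReal.ofReal (M.q J * (S J).offerProb a * ((S J).penalty a).real s) := by
    intro J
    have := (S J).penalty_prob a
    rw [ENNReal.ofReal_mul (h0 J), ofReal_measureReal]
  rw [measureReal_def]
  simp only [penaltyLaw, Measure.smul_apply, Measure.finsetSum_apply, smul_eq_mul, h]
  rw [← ENNReal.ofReal_sum_of_nonneg fun J _ => mul_nonneg (h0 J) measureReal_nonneg,
    ENNReal.toReal_mul, ENNReal.toReal_ofReal (inv_nonneg.2 (M.nodeProb_nonneg S a j)),
    ENNReal.toReal_ofReal (Finset.sum_nonneg fun J _ => mul_nonneg (h0 J) measureReal_nonneg)]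

theorem nodeProb_mul_penaltyLaw_real (s : Set ℝ) (j : ℕ) :
    M.nodeProb S a j * (M.penaltyLaw S a j).real s =
      ∑ J with (J a : ℕ) = j, M.q J * (S J).offerProb a * ((S J).penalty a).real s := by
  rw [penaltyLaw_real]
  -- If the state is never offered, every summand on the right vanishes too, so no positivity
  -- assumption is needed.
  by_cases h : M.nodeProb S a j = 0
  · rw [h, zero_mul]
    symm
    refine Finset.sum_eq_zero fun J hJ => ?_
    have := (Finset.sum_eq_zero_iff_of_nonneg fun J _ =>
      mul_nonneg (M.q_nonneg J) ((S J).offerProb_nonneg a)).1 h J hJ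
    rw [this, zero_mul]
  · rw [mul_inv_cancel_left₀ h]

theorem isProbabilityMeasure_penaltyLaw {j : ℕ} (h : 0 < M.nodeProb S a j) :
    IsProbabilityMeasure (M.penaltyLaw S a j) := by
  constructor
  have h1 : (M.penaltyLaw S a j).real univ = 1 := by
    rw [penaltyLaw_real]
    have : ∀ J, ((S J).penalty a).real univ = 1 := by
      intro J
      have := (S J).penalty_prob a
      simp
    simp only [this, mul_one]
    exact inv_mul_cancel₀ h.ne'
  rwa [measureReal_def, ENNReal.toReal_eq_one_iff] at h1

theorem ae_penaltyLaw {j : ℕ} {P : ℝ → Prop}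
    (h : ∀ J : V → Fin (M.n + 1), (J a : ℕ) = j → 0 < M.q J → 0 < (S J).offerProb a →
      ∀ᵐ x ∂(S J).penalty a, P x) : ∀ᵐ x ∂M.penaltyLaw S a j, P x := by
  refine Measure.ae_smul_measure ?_ _
  rw [ae_iff, Measure.finsetSum_apply]
  refine Finset.sum_eq_zero fun J hJ => ?_
  rw [Measure.smul_apply, smul_eq_mul, mul_eq_zero, ENNReal.ofReal_eq_zero]
  by_contra! hc
  have hq : 0 < M.q J := pos_of_mul_pos_left hc.1 ((S J).offerProb_nonneg a)
  exact hc.2 (ae_iff.1 (h J (Finset.mem_filter.1 hJ).2 hq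
    (pos_of_mul_pos_right hc.1 (M.q_nonneg J))))

theorem offerLaw_real_eq_sum_penaltyLaw {s : Set EReal} (hs : MeasurableSet s) (ht : ⊤ ∉ s) :
    (M.offerLaw S a).real s = ∑ k ∈ Finset.Icc 1 M.n,
      M.nodeProb S a k * (M.penaltyLaw S a k).real (Real.toEReal ⁻¹' s) := by
  rw [M.offerLaw_real S a hs ht]
  simp only [nodeProb_mul_penaltyLaw_real]
  rw [← Finset.sum_fiberwise_of_maps_to (s := Finset.univ) (t := Finset.range (M.n + 1))
    (g := fun J : V → Fin (M.n + 1) => (J a : ℕ)) fun J _ =>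
        Finset.mem_range.2 (J a).is_lt]
  symm
  refine Finset.sum_subset (fun k hk => ?_) fun k hk hk' => Finset.sum_eq_zero fun J hJ => ?_
  · simp only [Finset.mem_Icc] at hk
    simp only [Finset.mem_range]
    omega
  · simp only [Finset.mem_Icc, Finset.mem_range] at hk hk'
    have hJ0 : (J a : ℕ) = 0 := by
      have := (Finset.mem_filter.1 hJ).2
      omega
    rw [(S J).offerProb_eq_zero (Fin.ext hJ0), mul_zero, zero_mul]

end SpectrumMarket

namespace SpectrumMarket

variable {V : Type*} [Fintype V] [DecidableEq V] (M : SpectrumMarket V)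

/-! ### Sale probabilities -/

section Sale

variable {ι : Type*} [Fintype ι]

theorem saleProb_of_lt {x : ℝ} (hx : M.v < x) (y : ι → EReal) : M.saleProb x y = 0 :=
  if_neg (not_le.2 hx)

theorem saleProb_nonneg (x : ℝ) (y : ι → EReal) : 0 ≤ M.saleProb x y := by
  unfold saleProb
  split_ifs
  · positivity
  · exact le_rfl

theorem saleProb_le_one (x : ℝ) (y : ι → EReal) : M.saleProb x y ≤ 1 := by
  unfold saleProb
  split_ifs
  · exact min_le_left _ _
  · exact zero_le_one

theorem measurable_saleProb (x : ℝ) : Measurable fun y : ι → EReal => M.saleProb x y := by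
  classical
  unfold saleProb
  split_ifs
  · refine measurable_const.min (Measurable.div ?_ (Measurable.add_const ?_ _))
    · have h : Measurable fun b : ℕ => ((M.m - b : ℕ) : ℝ) := measurable_from_top
      convert h.comp (measurable_card_filter (ι := ι) (measurableSet_Iio (a := (x : EReal))))
        using 1
      ext y
      simp only [Function.comp, mem_Iio]
    · have h : Measurable fun b : ℕ => (b : ℝ) := measurable_from_top
      convert h.comp (measurable_card_filter (ι := ι) (measurableSet_singleton (x : EReal)))
        using 1
      ext y
      simp only [Function.comp, mem_singleton_iff]
  · exact measurable_const

open Classical in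
-- If fewer than `m` competitors quote at most `x`, the units left after serving the lower quotes
-- suffice for everyone tied at `x`.
theorem indicator_le_saleProb {x : ℝ} (hx : x ≤ M.v) (y : ι → EReal) :
    {y : ι → EReal | M.m ≤ (Finset.univ.filter fun k => y k ∈ Iic (x : EReal)).card}ᶜ.indicator
      (fun _ => (1 : ℝ)) y ≤ M.saleProb x y := by
  by_cases h : M.m ≤ (Finset.univ.filter fun k => y k ∈ Iic (x : EReal)).card
  · rw [indicator_of_notMem (by simpa using h)]
    exact M.saleProb_nonneg x y
  · rw [indicator_of_mem (by simpa using h), saleProb, if_pos hx]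
    refine le_min le_rfl ?_
    rw [le_div_iff₀ (by positivity), one_mul]
    have h2 : (Finset.univ.filter fun k => y k ∈ Iic (x : EReal)).card =
        (Finset.univ.filter fun k => y k < (x : EReal)).card +
        (Finset.univ.filter fun k => y k = (x : EReal)).card := by
      rw [← Finset.card_union_of_disjoint]
      · congr 1
        ext k
        simp [le_iff_lt_or_eq]
      · refine Finset.disjoint_filter.2 fun k _ h1 h2 => ?_
        exact h1.ne h2
    rw [h2] at h
    have h3 : (Finset.univ.filter fun k => y k = (x : EReal)).card + 1 ≤
        M.m - (Finset.univ.filter fun k => y k < (x : EReal)).card := by omega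
    exact_mod_cast h3

open Classical in
-- When all competitors quote exactly `x`, the `m` units are shared among `l` sellers, and the sale
-- fails with probability 1 - m/l. Keeping this loss gives the strict inequality that excludes
-- atoms; elsewhere the crude bounds 0 and 1 suffice.
theorem saleProb_add_le_indicator (hι : Fintype.card ι = M.l - 1) {x : ℝ} (hx : x ≤ M.v)
    (y : ι → EReal) :
    M.saleProb x y + (1 - (M.m : ℝ) / M.l) *
        (univ.pi fun _ : ι => {(x : EReal)}).indicator (fun _ => (1 : ℝ)) y ≤
      {y : ι → EReal | M.m ≤ (Finset.univ.filter fun k => y k ∈ Iio (x : EReal)).card}ᶜ.indicator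
        (fun _ => (1 : ℝ)) y := by
  have hm := M.one_le_m
  have hl := M.m_lt_l
  by_cases hy : y ∈ univ.pi fun _ : ι => {(x : EReal)}
  · have h1 : ∀ k, y k = x := fun k => hy k (mem_univ k)
    rw [indicator_of_mem hy, indicator_of_mem (by simp [h1]; omega), saleProb, if_pos hx]
    have h2 : ((M.l - 1 : ℕ) : ℝ) + 1 = M.l := by
      rw [Nat.cast_sub (by omega)]; simp
    simp only [h1, lt_self_iff_false, Finset.filter_false, Finset.card_empty, tsub_zero,
      Finset.filter_true, Finset.card_univ, hι, h2]
    linarith [min_le_right 1 ((M.m : ℝ) / M.l)]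
  · rw [indicator_of_notMem hy, mul_zero, add_zero]
    by_cases h : M.m ≤ (Finset.univ.filter fun k => y k ∈ Iio (x : EReal)).card
    · rw [indicator_of_notMem (by simpa using h), saleProb, if_pos hx]
      have : M.m - (Finset.univ.filter fun k => y k < (x : EReal)).card = 0 :=
        Nat.sub_eq_zero_of_le h
      rw [this]
      simp
    · rw [indicator_of_mem (by simpa using h)]
      exact M.saleProb_le_one x y

open Classical in
theorem integral_indicator_card_filter (hι : Fintype.card ι = M.l - 1) (μ : Measure EReal)
    [IsProbabilityMeasure μ] {s : Set EReal} (hs : MeasurableSet s) :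
    ∫ y, {y : ι → EReal | M.m ≤ (Finset.univ.filter fun k => y k ∈ s).card}ᶜ.indicator
      (fun _ => (1 : ℝ)) y ∂(Measure.pi fun _ : ι => μ) = 1 - M.w (μ.real s) := by
  have hm : MeasurableSet
      {y : ι → EReal | M.m ≤ (Finset.univ.filter fun k => y k ∈ s).card} :=
    measurable_card_filter hs measurableSet_Ici
  rw [integral_indicator_const _ hm.compl, smul_eq_mul, mul_one, probReal_compl_eq_one_sub hm,
    pi_real_le_card_filter μ hs, hι, w]

theorem integrable_saleProb (μ : Measure (ι → EReal)) [IsProbabilityMeasure μ] (x : ℝ) :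
    Integrable (fun y => M.saleProb x y) μ := by
  refine Integrable.of_bound (M.measurable_saleProb x).aestronglyMeasurable 1
    (ae_of_all _ fun y => ?_)
  rw [Real.norm_of_nonneg (M.saleProb_nonneg x y)]
  exact M.saleProb_le_one x y

theorem integral_saleProb_ge (hι : Fintype.card ι = M.l - 1) (μ : Measure EReal)
    [IsProbabilityMeasure μ] {x : ℝ} (hx : x ≤ M.v) :
    1 - M.w (μ.real (Iic x)) ≤ ∫ y, M.saleProb x y ∂(Measure.pi fun _ : ι => μ) := by
  classical
  rw [← M.integral_indicator_card_filter hι μ measurableSet_Iic]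
  refine integral_mono ?_ (M.integrable_saleProb _ x) fun y => ?_
  · exact (integrable_const _).indicator (measurable_card_filter measurableSet_Iic
      measurableSet_Ici).compl
  · refine le_of_eq_of_le ?_ (M.indicator_le_saleProb hx y)
    congr!

theorem integral_saleProb_add_le (hι : Fintype.card ι = M.l - 1) (μ : Measure EReal)
    [IsProbabilityMeasure μ] {x : ℝ} (hx : x ≤ M.v) :
    ∫ y, M.saleProb x y ∂(Measure.pi fun _ : ι => μ) +
      (1 - (M.m : ℝ) / M.l) * μ.real {(x : EReal)} ^ (M.l - 1) ≤
      1 - M.w (μ.real (Iio x)) := by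
  classical
  have hm : MeasurableSet (univ.pi fun _ : ι => {(x : EReal)}) :=
    MeasurableSet.univ_pi fun _ => measurableSet_singleton _
  have hi : Integrable ((univ.pi fun _ : ι => {(x : EReal)}).indicator (fun _ => (1 : ℝ)))
      (Measure.pi fun _ : ι => μ) := (integrable_const _).indicator hm
  have h1 : ∫ y, (univ.pi fun _ : ι => {(x : EReal)}).indicator (fun _ => (1 : ℝ)) y
      ∂(Measure.pi fun _ : ι => μ) = μ.real {(x : EReal)} ^ (M.l - 1) := by
    rw [integral_indicator_const _ hm, smul_eq_mul, mul_one, measureReal_def, Measure.pi_pi,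
      Finset.prod_const, Finset.card_univ, hι, ENNReal.toReal_pow, measureReal_def]
  rw [← M.integral_indicator_card_filter hι μ measurableSet_Iio, ← h1, ← integral_const_mul,
    ← integral_add (M.integrable_saleProb _ x) (hi.const_mul _)]
  refine integral_mono ((M.integrable_saleProb _ x).add (hi.const_mul _)) ?_ fun y => ?_
  · exact (integrable_const _).indicator (measurable_card_filter measurableSet_Iio
      measurableSet_Ici).compl
  · refine (M.saleProb_add_le_indicator hι hx y).trans_eq ?_
    congr!

end Sale

variable {M} {S : Fin M.l → M.Strategy} (i : Fin M.l) (a : V)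

theorem winProb_eq (hS : ∀ i k, S i = S k) (x : ℝ) :
    M.winProb S i a x =
    ∫ y, M.saleProb x y ∂(Measure.pi fun _ : {k : Fin M.l // k ≠ i} => M.offerLaw (S i) a) := by
  have : (fun k : {k : Fin M.l // k ≠ i} => M.offerLaw (S k) a) =
      fun _ => M.offerLaw (S i) a := funext fun k => by rw [hS k i]
  rw [winProb, this]

theorem winProb_of_lt {x : ℝ} (hx : M.v < x) : M.winProb S i a x = 0 := by
  simp [winProb, M.saleProb_of_lt hx]

theorem winProb_nonneg (x : ℝ) : 0 ≤ M.winProb S i a x :=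
  integral_nonneg fun y => M.saleProb_nonneg x y

theorem winProb_le_one (x : ℝ) : M.winProb S i a x ≤ 1 := by
  have : ∀ k : {k : Fin M.l // k ≠ i}, IsProbabilityMeasure (M.offerLaw (S k) a) :=
    fun k => M.isProbabilityMeasure_offerLaw (S k) a
  have h := integral_mono (M.integrable_saleProb
    (Measure.pi fun k : {k : Fin M.l // k ≠ i} => M.offerLaw (S k) a) x) (integrable_const 1)
    fun y => M.saleProb_le_one x y
  simpa [winProb] using h

theorem winProb_ge (hS : ∀ i k, S i = S k) {x : ℝ} (hx : x ≤ M.v) :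
    1 - M.w ((M.offerLaw (S i) a).real (Iic x)) ≤ M.winProb S i a x := by
  have := M.isProbabilityMeasure_offerLaw (S i) a
  rw [winProb_eq i a hS]
  exact M.integral_saleProb_ge (by simp [Fintype.card_subtype_compl]) _ hx

theorem winProb_add_le (hS : ∀ i k, S i = S k) {x : ℝ} (hx : x ≤ M.v) :
    M.winProb S i a x +
      (1 - (M.m : ℝ) / M.l) * (M.offerLaw (S i) a).real {(x : EReal)} ^ (M.l - 1) ≤
      1 - M.w ((M.offerLaw (S i) a).real (Iio x)) := by
  have := M.isProbabilityMeasure_offerLaw (S i) a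
  rw [winProb_eq i a hS]
  exact M.integral_saleProb_add_le (by simp [Fintype.card_subtype_compl]) _ hx

end SpectrumMarket

namespace SpectrumMarket

variable {V : Type*} [Fintype V] [DecidableEq V] {M : SpectrumMarket V}

/-! ### Prices as functions of penalties -/

section Price

variable {j : ℕ} {x y : ℝ}

theorem f_mem_prices (hx : x ∈ M.g j '' M.prices) : M.f j x ∈ M.prices :=
  Function.invFunOn_mem hx

theorem g_f (hx : x ∈ M.g j '' M.prices) : M.g j (M.f j x) = x :=
  Function.invFunOn_eq hx

theorem f_g (hj : 1 ≤ j) (hjn : j ≤ M.n) (hx : x ∈ M.prices) : M.f j (M.g j x) = x :=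
  (M.g_strictMono j hj hjn).injOn.leftInvOn_invFunOn hx

theorem f_lt_f (hj : 1 ≤ j) (hjn : j ≤ M.n) (hx : x ∈ M.g j '' M.prices)
    (hy : y ∈ M.g j '' M.prices) (hxy : x < y) : M.f j x < M.f j y := by
  rwa [← (M.g_strictMono j hj hjn).lt_iff_lt (f_mem_prices hx) (f_mem_prices hy), g_f hx, g_f hy]

theorem f_le_f (hj : 1 ≤ j) (hjn : j ≤ M.n) (hx : x ∈ M.g j '' M.prices)
    (hy : y ∈ M.g j '' M.prices) (hxy : x ≤ y) : M.f j x ≤ M.f j y :=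
  hxy.eq_or_lt.elim (fun h => h ▸ le_rfl) fun h => (f_lt_f hj hjn hx hy h).le

theorem c_lt_f_iff (hj : 1 ≤ j) (hjn : j ≤ M.n) (hx : x ∈ M.g j '' M.prices) :
    M.c < M.f j x ↔ M.g j M.c < x := by
  rw [← (M.g_strictMono j hj hjn).lt_iff_lt M.c_mem (f_mem_prices hx), g_f hx]

theorem c_lt_f_v (hj : 1 ≤ j) (hjn : j ≤ M.n) : M.c < M.f j M.v :=
  (c_lt_f_iff hj hjn (M.v_mem j hj hjn)).2 (M.g_c_lt_v j hj hjn)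

theorem Icc_c_f_v_subset (hj : 1 ≤ j) (hjn : j ≤ M.n) : Icc M.c (M.f j M.v) ⊆ M.prices :=
  M.ordConnected_prices.out M.c_mem (f_mem_prices (M.v_mem j hj hjn))

theorem image_g_Icc (hj : 1 ≤ j) (hjn : j ≤ M.n) :
    M.g j '' Icc M.c (M.f j M.v) = Icc (M.g j M.c) M.v := by
  have h := Icc_c_f_v_subset (M := M) hj hjn
  have hle := (c_lt_f_v (M := M) hj hjn).le
  refine Subset.antisymm ?_ ?_
  · rintro _ ⟨p, hp, rfl⟩
    refine ⟨(M.g_strictMono j hj hjn).monotoneOn M.c_mem (h hp) hp.1, ?_⟩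
    have := (M.g_strictMono j hj hjn).monotoneOn (h hp)
      (f_mem_prices (M.v_mem j hj hjn)) hp.2
    rwa [g_f (M.v_mem j hj hjn)] at this
  · have := intermediate_value_Icc hle ((M.g_continuous j hj hjn).mono h)
    rwa [g_f (M.v_mem j hj hjn)] at this

theorem mem_image_g (hj : 1 ≤ j) (hjn : j ≤ M.n) (h1 : M.g j M.c ≤ x) (h2 : x ≤ M.v) :
    x ∈ M.g j '' M.prices := by
  have : x ∈ M.g j '' Icc M.c (M.f j M.v) := by
    rw [image_g_Icc hj hjn]
    exact ⟨h1, h2⟩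
  exact image_mono (Icc_c_f_v_subset hj hjn) this

end Price

/-! ### Best responses -/

theorem payoff_eq (S : Fin M.l → M.Strategy) (i : Fin M.l) {J : V → Fin (M.n + 1)}
    (ψ : M.StrategyAt J) : M.payoff S i J ψ = ∑ b, ψ.offerProb b *
      ∫ x, (M.f (J b) x - M.c) * M.winProb S i b x ∂(ψ.penalty b) := by
  simp only [payoff, StrategyAt.offerProb, Finset.mul_sum, Finset.sum_mul]
  rw [Finset.sum_comm' (t' := Finset.univ)
    (s' := fun b => Finset.univ.filter fun I : Finset V => b ∈ I)]
  simp

/-- The deviation that quotes the penalty `x` for sure at node `a`. -/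
noncomputable def StrategyAt.quote {J : V → Fin (M.n + 1)} (ψ : M.StrategyAt J) (a : V) (x : ℝ)
    (hx : x ∈ M.g (J a) '' M.prices) : M.StrategyAt J where
  select := ψ.select
  select_nonneg := ψ.select_nonneg
  select_sum := ψ.select_sum
  select_indep := ψ.select_indep
  penalty := Function.update ψ.penalty a (Measure.dirac x)
  penalty_prob b := by
    rcases eq_or_ne b a with rfl | h
    · rw [Function.update_self]
      infer_instance
    · rw [Function.update_of_ne h]
      exact ψ.penalty_prob b
  penalty_mem b hb := by
    rcases eq_or_ne b a with rfl | h
    · rw [Function.update_self, ae_dirac_eq]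
      exact hx
    · rw [Function.update_of_ne h]
      exact ψ.penalty_mem b hb
  penalty_integrable b hb := by
    rcases eq_or_ne b a with rfl | h
    · rw [Function.update_self]
      exact (integrable_dirac (by simp)).integrableOn
    · rw [Function.update_of_ne h]
      exact ψ.penalty_integrable b hb

/-- The deviation `quote` changes the payoff only through node `a`; the terms of the other nodes
cancel, and the positive offer probability can be divided out. -/
theorem IsNash.le_integral {S : Fin M.l → M.Strategy} (hS : M.IsNash S) (i : Fin M.l) {a : V}
    {J : V → Fin (M.n + 1)} (hq : 0 < M.q J) (ho : 0 < (S i J).offerProb a) {x : ℝ}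
    (hx : x ∈ M.g (J a) '' M.prices) :
    (M.f (J a) x - M.c) * M.winProb S i a x ≤
      ∫ y, (M.f (J a) y - M.c) * M.winProb S i a y ∂((S i J).penalty a) := by
  have h := hS i J hq ((S i J).quote a x hx)
  rw [payoff_eq, payoff_eq, ← Finset.add_sum_erase _ _ (Finset.mem_univ a),
    ← Finset.add_sum_erase _ _ (Finset.mem_univ a)] at h
  have h1 : ∀ b ∈ Finset.univ.erase a, ((S i J).quote a x hx).offerProb b *
      ∫ y, (M.f (J b) y - M.c) * M.winProb S i b y ∂(((S i J).quote a x hx).penalty b) =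
      (S i J).offerProb b *
        ∫ y, (M.f (J b) y - M.c) * M.winProb S i b y ∂((S i J).penalty b) := by
    intro b hb
    have : ((S i J).quote a x hx).penalty b = (S i J).penalty b :=
      Function.update_of_ne (Finset.ne_of_mem_erase hb) _ _
    rw [this]
    rfl
  rw [Finset.sum_congr rfl h1, add_le_add_iff_right] at h
  have h2 : ((S i J).quote a x hx).penalty a = Measure.dirac x := Function.update_self ..
  have h3 : ((S i J).quote a x hx).offerProb a = (S i J).offerProb a := rfl
  rw [h2, h3, integral_dirac] at h
  exact le_of_mul_le_mul_left h ho

/-! ### Optimality of almost every quote under a symmetric profile -/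

section Symmetric

variable {S : Fin M.l → M.Strategy}

/-- For x < y the lower bound at x dominates the upper bound at y, because quotes ≤ x are quotes <
y. The monotonicity supplies measurability of the win probability. -/
theorem antitone_winProb (hS : ∀ i k, S i = S k) (i : Fin M.l) (a : V) :
    Antitone (M.winProb S i a) := by
  intro x y hxy
  rcases hxy.eq_or_lt with rfl | hxy
  · exact le_rfl
  rcases lt_or_ge M.v y with hy | hy
  · rw [winProb_of_lt i a hy]
    exact winProb_nonneg i a x
  · have := M.isProbabilityMeasure_offerLaw (S i) a
    have h1 := winProb_ge i a hS (hxy.le.trans hy)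
    have h2 := winProb_add_le i a hS hy
    have h3 : 0 ≤ (1 - (M.m : ℝ) / M.l) *
        (M.offerLaw (S i) a).real {(y : EReal)} ^ (M.l - 1) := by
      refine mul_nonneg (sub_nonneg.2 ?_) (pow_nonneg measureReal_nonneg _)
      exact div_le_one_of_le₀ (by exact_mod_cast M.m_lt_l.le) (Nat.cast_nonneg _)
    have h4 : M.w ((M.offerLaw (S i) a).real (Iic (x : EReal))) ≤
        M.w ((M.offerLaw (S i) a).real (Iio (y : EReal))) := by
      refine M.strictMonoOn_w.monotoneOn ⟨measureReal_nonneg, measureReal_le_one⟩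
        ⟨measureReal_nonneg, measureReal_le_one⟩ (measureReal_mono ?_)
      exact fun z hz => lt_of_le_of_lt hz (EReal.coe_lt_coe_iff.2 hxy)
    linarith

theorem integrable_gain (hS : ∀ i k, S i = S k) (i : Fin M.l) {a : V}
    {J : V → Fin (M.n + 1)} (hJ : J a ≠ 0) (ψ : M.StrategyAt J) :
    Integrable (fun x => (M.f (J a) x - M.c) * M.winProb S i a x) (ψ.penalty a) := by
  have := ψ.penalty_prob a
  have h1 : (fun x => (M.f (J a) x - M.c) * M.winProb S i a x) =
      (Iic M.v).indicator (fun x => (M.f (J a) x - M.c) * M.winProb S i a x) := by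
    ext x
    by_cases hx : x ∈ Iic M.v
    · rw [indicator_of_mem hx]
    · rw [indicator_of_notMem hx, winProb_of_lt i a (not_le.1 hx), mul_zero]
  rw [h1, integrable_indicator_iff measurableSet_Iic]
  refine Integrable.mul_bdd (c := 1) ((ψ.penalty_integrable a hJ).sub (integrable_const _))
    (antitone_winProb hS i a).measurable.aestronglyMeasurable (ae_of_all _ fun x => ?_)
  rw [Real.norm_of_nonneg (winProb_nonneg i a x)]
  exact winProb_le_one i a x

/-- In equilibrium, almost every quoted penalty maximizes the expected gain at the node. -/
theorem IsSymmetricNash.exists_max (hS : M.IsSymmetricNash S) (i : Fin M.l) (a : V) {j : ℕ}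
    (hj : 1 ≤ j) (hα : 0 < M.nodeProb (S i) a j) :
    ∃ U, (∀ x ∈ M.g j '' M.prices, (M.f j x - M.c) * M.winProb S i a x ≤ U) ∧
      ∀ᵐ x ∂M.penaltyLaw (S i) a j, x ∈ M.g j '' M.prices ∧
        (M.f j x - M.c) * M.winProb S i a x = U := by
  have key : ∀ J : V → Fin (M.n + 1), (J a : ℕ) = j → 0 < M.q J → 0 < (S i J).offerProb a →
      ∃ U, (∀ x ∈ M.g j '' M.prices, (M.f j x - M.c) * M.winProb S i a x ≤ U) ∧
      ∀ᵐ x ∂(S i J).penalty a, x ∈ M.g j '' M.prices ∧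
        (M.f j x - M.c) * M.winProb S i a x = U := by
    rintro J rfl hq ho
    have hJ : J a ≠ 0 := fun h => by simp [h] at hj
    have hprob := (S i J).penalty_prob a
    refine ⟨_, fun x hx => hS.1.le_integral i hq ho hx, ?_⟩
    have hint := integrable_gain hS.2 i hJ (S i J)
    set u := ∫ y, (M.f (J a) y - M.c) * M.winProb S i a y ∂((S i J).penalty a) with hu
    have h0 : 0 ≤ᵐ[(S i J).penalty a]
        fun x => u - (M.f (J a) x - M.c) * M.winProb S i a x := by
      filter_upwards [(S i J).penalty_mem a hJ] with x hx
      exact sub_nonneg.2 (hS.1.le_integral i hq ho hx)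
    have h1 : ∫ x, (u - (M.f (J a) x - M.c) * M.winProb S i a x) ∂((S i J).penalty a) = 0 := by
      rw [integral_sub (integrable_const _) hint, ← hu]
      simp
    rw [integral_eq_zero_iff_of_nonneg_ae h0 ((integrable_const _).sub hint)] at h1
    filter_upwards [(S i J).penalty_mem a hJ, h1] with x hx hx'
    exact ⟨hx, (sub_eq_zero.1 hx').symm⟩
  -- A state vector that contributes to the positive node probability; its maximum serves as the
  -- common value `U`.
  obtain ⟨J₀, hJ₀, hpos⟩ := Finset.exists_lt_of_sum_lt
    (s := Finset.univ.filter fun J : V → Fin (M.n + 1) => (J a : ℕ) = j) (f := fun _ => (0 : ℝ))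
    (g := fun J => M.q J * (S i J).offerProb a) (by rw [Finset.sum_const_zero]; exact hα)
  obtain ⟨U, hU, hU'⟩ := key J₀ (Finset.mem_filter.1 hJ₀).2
    (pos_of_mul_pos_left hpos ((S i J₀).offerProb_nonneg a))
    (pos_of_mul_pos_right hpos (M.q_nonneg J₀))
  have hex : ∃ x ∈ M.g j '' M.prices, (M.f j x - M.c) * M.winProb S i a x = U := by
    have := (S i J₀).penalty_prob a
    exact hU'.exists
  refine ⟨U, hU, ae_penaltyLaw fun J hJ hq ho => ?_⟩
  obtain ⟨U', h1, h2⟩ := key J hJ hq ho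
  have hex' : ∃ x ∈ M.g j '' M.prices, (M.f j x - M.c) * M.winProb S i a x = U' := by
    have := (S i J).penalty_prob a
    exact h2.exists
  obtain ⟨x, hx, hxU⟩ := hex
  obtain ⟨x', hx', hxU'⟩ := hex'
  -- Both are attained maxima of the same function, which depends on the state vector only through
  -- the state at `a`.
  have : U' = U := le_antisymm (hxU' ▸ hU x' hx') (hxU ▸ h1 x hx)
  rwa [this] at h2

end Symmetric

end SpectrumMarket

namespace SpectrumMarket

variable {V : Type*} [Fintype V] [DecidableEq V] {M : SpectrumMarket V}

/-! ### Absence of atoms -/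

section Equilibrium

variable {S : Fin M.l → M.Strategy}

theorem offerLaw_real_lt_one (S : M.Strategy) (a : V) {s : Set EReal} (hs : MeasurableSet s)
    (ht : ⊤ ∉ s) : (M.offerLaw S a).real s < 1 := by
  rw [offerLaw_real_eq_sum_penaltyLaw hs ht]
  refine lt_of_le_of_lt (Finset.sum_le_sum fun k _ => ?_) (M.sum_nodeProb_lt_one S a)
  rcases (M.nodeProb_nonneg S a k).eq_or_lt with h | h
  · rw [← h, zero_mul]
  · have := isProbabilityMeasure_penaltyLaw h
    exact mul_le_of_le_one_right h.le measureReal_le_one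

theorem winProb_pos (hS : ∀ i k, S i = S k) (i : Fin M.l) (a : V) {x : ℝ} (hx : x ≤ M.v) :
    0 < M.winProb S i a x :=
  (sub_pos.2 (M.w_lt_one measureReal_nonneg
    (offerLaw_real_lt_one (S i) a measurableSet_Iic (by simp)))).trans_le (winProb_ge i a hS hx)

/-- Quoting `v` already earns a positive gain, so the maximum is positive. This rules out penalties
above `v`, which never sell, and prices not above the cost. -/
theorem IsSymmetricNash.exists_max_pos (hS : M.IsSymmetricNash S) (i : Fin M.l) (a : V) {j : ℕ}
    (hj : 1 ≤ j) (hjn : j ≤ M.n) (hα : 0 < M.nodeProb (S i) a j) :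
    ∃ U, (∀ x ∈ M.g j '' M.prices, (M.f j x - M.c) * M.winProb S i a x ≤ U) ∧
      ∀ᵐ x ∂M.penaltyLaw (S i) a j, M.g j M.c < x ∧ x ≤ M.v ∧
        (M.f j x - M.c) * M.winProb S i a x = U := by
  obtain ⟨U, hU, hae⟩ := hS.exists_max i a hj hα
  refine ⟨U, hU, ?_⟩
  have hpos : 0 < U := lt_of_lt_of_le (mul_pos (sub_pos.2 (c_lt_f_v hj hjn))
    (winProb_pos hS.2 i a le_rfl)) (hU M.v (M.v_mem j hj hjn))
  filter_upwards [hae] with x hx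
  have hxv : x ≤ M.v := by
    by_contra! h
    rw [winProb_of_lt i a h, mul_zero] at hx
    exact hpos.ne hx.2
  refine ⟨?_, hxv, hx.2⟩
  rw [← c_lt_f_iff hj hjn hx.1, ← sub_pos]
  rw [← hx.2] at hpos
  exact pos_of_mul_pos_left hpos (winProb_nonneg i a x)

/-- An atom must come from some state for which `x` is then optimal. A slightly lower price avoids
the tie and raises the win probability by a fixed amount, a contradiction. -/
theorem IsSymmetricNash.offerLaw_real_singleton (hS : M.IsSymmetricNash S) (i : Fin M.l) (a : V)
    (x : ℝ) : (M.offerLaw (S i) a).real {(x : EReal)} = 0 := by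
  by_contra hne
  have hpos : 0 < (M.offerLaw (S i) a).real {(x : EReal)} :=
    lt_of_le_of_ne measureReal_nonneg (Ne.symm hne)
  have hsum := hpos
  rw [offerLaw_real_eq_sum_penaltyLaw (measurableSet_singleton _) (by simp)] at hsum
  obtain ⟨k, hk, hk0⟩ := Finset.exists_lt_of_sum_lt (f := fun _ => (0 : ℝ))
    (Finset.sum_const_zero.trans_lt hsum)
  obtain ⟨h1, hn⟩ := Finset.mem_Icc.1 hk
  have hα : 0 < M.nodeProb (S i) a k := pos_of_mul_pos_left hk0 measureReal_nonneg
  have hν : 0 < (M.penaltyLaw (S i) a k).real (Real.toEReal ⁻¹' {(x : EReal)}) :=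
    pos_of_mul_pos_right hk0 hα.le
  have hpre : Real.toEReal ⁻¹' {(x : EReal)} = {x} := by
    ext y
    simp
  rw [hpre] at hν
  obtain ⟨U, hU, hae⟩ := hS.exists_max_pos i a h1 hn hα
  obtain ⟨hcx, hxv, hxU⟩ : M.g k M.c < x ∧ x ≤ M.v ∧
      (M.f k x - M.c) * M.winProb S i a x = U := by
    by_contra hcon
    refine hν.ne' ?_
    rw [measureReal_def, measure_mono_null _ (ae_iff.1 hae), ENNReal.toReal_zero]
    rintro y rfl
    exact hcon
  have hxm := mem_image_g h1 hn hcx.le hxv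
  have hf : M.c < M.f k x := (c_lt_f_iff h1 hn hxm).2 hcx
  set W := M.winProb S i a x
  set B := 1 - M.w ((M.offerLaw (S i) a).real (Iio (x : EReal)))
  have hWB : W < B := by
    refine lt_of_lt_of_le ?_ (winProb_add_le i a hS.2 hxv)
    have hl : (M.m : ℝ) / M.l < 1 := by
      have := M.m_lt_l
      rw [div_lt_one (by exact_mod_cast (by omega : 0 < M.l))]
      exact_mod_cast this
    have : 0 < (1 - (M.m : ℝ) / M.l) *
        (M.offerLaw (S i) a).real {(x : EReal)} ^ (M.l - 1) :=
      mul_pos (sub_pos.2 hl) (pow_pos hpos _)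
    linarith
  have hW : 0 < W := winProb_pos hS.2 i a hxv
  have hB : 0 < B := hW.trans hWB
  -- Chosen so that t * B is the midpoint of `W` and `B`: scaling the profit margin by t < 1 and
  -- winning with probability at least `B` still beats the gain with `W`.
  set t := (W + B) / (2 * B) with ht
  have htB : t * B = (W + B) / 2 := by
    rw [ht]
    field_simp
  have ht0 : 0 < t := by positivity
  have ht1 : t < 1 := by
    rw [ht, div_lt_one (by positivity)]
    linarith
  set p := M.c + (M.f k x - M.c) * t with hp
  have hpc : M.c ≤ p := by
    have := mul_pos (sub_pos.2 hf) ht0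
    linarith
  have hpf : p < M.f k x := by
    have := mul_lt_mul_of_pos_left ht1 (sub_pos.2 hf)
    linarith
  have hpm : p ∈ M.prices :=
    M.ordConnected_prices.out M.c_mem (f_mem_prices hxm) ⟨hpc, hpf.le⟩
  have hgx : M.g k p < x := by
    have := M.g_strictMono k h1 hn hpm (f_mem_prices hxm) hpf
    rwa [g_f hxm] at this
  have h2 := hU _ (mem_image_of_mem _ hpm)
  rw [f_g h1 hn hpm] at h2
  have h3 : B ≤ M.winProb S i a (M.g k p) := by
    refine le_trans (sub_le_sub_left ?_ 1) (winProb_ge i a hS.2 (hgx.le.trans hxv))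
    have := M.isProbabilityMeasure_offerLaw (S i) a
    refine M.strictMonoOn_w.monotoneOn ⟨measureReal_nonneg, measureReal_le_one⟩
      ⟨measureReal_nonneg, measureReal_le_one⟩ (measureReal_mono ?_)
    exact fun z hz => lt_of_le_of_lt hz (EReal.coe_lt_coe_iff.2 hgx)
  have h4 : (M.f k x - M.c) * (t * B) ≤ (M.f k x - M.c) * W := by
    calc (M.f k x - M.c) * (t * B) = (p - M.c) * B := by rw [hp]; ring
      _ ≤ (p - M.c) * M.winProb S i a (M.g k p) :=
        mul_le_mul_of_nonneg_left h3 (sub_nonneg.2 hpc)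
      _ ≤ _ := by rw [hxU]; exact h2
  have h5 := le_of_mul_le_mul_left h4 (sub_pos.2 hf)
  linarith

/-! ### The distribution function of a quote -/

/-- The probability that a primary with strategy `S` quotes a penalty `≤ x` at node `a`. -/
noncomputable def quoteCdf (S : M.Strategy) (a : V) (x : ℝ) : ℝ :=
  (M.offerLaw S a).real (Iic (x : EReal))

theorem quoteCdf_eq_sum (S : M.Strategy) (a : V) (x : ℝ) :
    quoteCdf S a x =
      ∑ k ∈ Finset.Icc 1 M.n, M.nodeProb S a k * (M.penaltyLaw S a k).real (Iic x) := by
  have : Real.toEReal ⁻¹' Iic (x : EReal) = Iic x := by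
    ext y
    simp
  rw [quoteCdf, offerLaw_real_eq_sum_penaltyLaw measurableSet_Iic (by simp), this]

theorem quoteCdf_mem_Icc (S : M.Strategy) (a : V) (x : ℝ) : quoteCdf S a x ∈ Icc (0 : ℝ) 1 :=
  have := M.isProbabilityMeasure_offerLaw S a
  ⟨measureReal_nonneg, measureReal_le_one⟩

theorem one_sub_w_quoteCdf_pos (S : M.Strategy) (a : V) (x : ℝ) :
    0 < 1 - M.w (quoteCdf S a x) :=
  sub_pos.2 (M.w_lt_one measureReal_nonneg
    (offerLaw_real_lt_one S a measurableSet_Iic (by simp)))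

theorem IsSymmetricNash.winProb_eq_quoteCdf (hS : M.IsSymmetricNash S) (i : Fin M.l) (a : V)
    {x : ℝ} (hx : x ≤ M.v) : M.winProb S i a x = 1 - M.w (quoteCdf (S i) a x) := by
  have := M.isProbabilityMeasure_offerLaw (S i) a
  have h0 := hS.offerLaw_real_singleton i a x
  refine le_antisymm ?_ (winProb_ge i a hS.2 hx)
  have h := winProb_add_le i a hS.2 hx
  have hl : M.l - 1 ≠ 0 := by
    have := M.m_lt_l
    have := M.one_le_m
    omega
  rw [h0, zero_pow hl, mul_zero, add_zero] at h
  refine h.trans_eq ?_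
  have h1 : (M.offerLaw (S i) a).real (Iic (x : EReal)) =
      (M.offerLaw (S i) a).real (Iio (x : EReal)) := by
    rw [← Iio_union_right, measureReal_union (by simp) (measurableSet_singleton _), h0, add_zero]
  rw [quoteCdf, h1]

/-- Dominated convergence: off the null event that the quote equals `x`, the indicator is locally
constant in the threshold. -/
theorem IsSymmetricNash.continuous_quoteCdf (hS : M.IsSymmetricNash S) (i : Fin M.l) (a : V) :
    Continuous (quoteCdf (S i) a) := by
  have := M.isProbabilityMeasure_offerLaw (S i) a
  have h : quoteCdf (S i) a = fun x : ℝ =>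
      ∫ y, (Iic (x : EReal)).indicator (fun _ => (1 : ℝ)) y ∂(M.offerLaw (S i) a) := by
    ext x
    rw [integral_indicator_const _ measurableSet_Iic, smul_eq_mul, mul_one, quoteCdf]
  rw [h, continuous_iff_continuousAt]
  intro x
  refine continuousAt_of_dominated (bound := fun _ => 1) ?_ ?_ (integrable_const _) ?_
  · exact Filter.Eventually.of_forall fun z =>
      (measurable_const.indicator measurableSet_Iic).aestronglyMeasurable
  · refine Filter.Eventually.of_forall fun z => ae_of_all _ fun y => ?_
    exact (norm_indicator_le_norm_self _ _).trans (by simp)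
  · have h0 : (M.offerLaw (S i) a) {(x : EReal)} = 0 := by
      have := hS.offerLaw_real_singleton i a x
      rwa [measureReal_eq_zero_iff] at this
    have hne : ∀ᵐ y ∂M.offerLaw (S i) a, y ≠ (x : EReal) := by
      rw [ae_iff]
      simpa using h0
    filter_upwards [hne] with y hy
    have hc : ContinuousAt Real.toEReal x := continuous_coe_real_ereal.continuousAt
    rcases hy.lt_or_gt with hlt | hlt
    · refine (continuousAt_const (y := (1 : ℝ))).congr ?_
      filter_upwards [hc.eventually (lt_mem_nhds hlt)] with z hz
      rw [indicator_of_mem (mem_Iic.2 hz.le)]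
    · refine (continuousAt_const (y := (0 : ℝ))).congr ?_
      filter_upwards [hc.eventually (gt_mem_nhds hlt)] with z hz
      rw [indicator_of_notMem (by simpa using hz)]

end Equilibrium

end SpectrumMarket

namespace SpectrumMarket

variable {V : Type*} [Fintype V] [DecidableEq V] {M : SpectrumMarket V}

/-! ### Best penalties -/

/-- The expected gain at node `a` in state `j` from the penalty `x ≤ v`, in the absence of ties. -/
noncomputable def gain (S : M.Strategy) (a : V) (j : ℕ) (x : ℝ) : ℝ :=
  (M.f j x - M.c) * (1 - M.w (quoteCdf S a x))

/-- The penalties that maximize the gain at node `a` in state `j`. -/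
def bestPenalties (S : M.Strategy) (a : V) (j : ℕ) : Set ℝ :=
  {x ∈ Icc (M.g j M.c) M.v | IsMaxOn (gain S a j) (Icc (M.g j M.c) M.v) x}

section Best

variable {j k : ℕ} {a : V} {x y : ℝ}

theorem g_c_lt_of_mem_bestPenalties {S : M.Strategy} (hj : 1 ≤ j) (hjn : j ≤ M.n)
    (hx : x ∈ bestPenalties S a j) : M.g j M.c < x := by
  rw [← c_lt_f_iff hj hjn (mem_image_g hj hjn hx.1.1 hx.1.2), ← sub_pos]
  have h1 : gain S a j M.v ≤ gain S a j x := hx.2 ⟨(M.g_c_lt_v j hj hjn).le, le_rfl⟩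
  have h2 : 0 < gain S a j M.v :=
    mul_pos (sub_pos.2 (c_lt_f_v hj hjn)) (one_sub_w_quoteCdf_pos S a _)
  exact pos_of_mul_pos_left (h2.trans_le h1) (one_sub_w_quoteCdf_pos S a x).le

theorem mem_bestPenalties_of_quoteCdf_eq {S : M.Strategy} (hj : 1 ≤ j) (hjn : j ≤ M.n)
    (hx : x ∈ bestPenalties S a j) (hxy : x ≤ y) (hy : y ≤ M.v)
    (h : quoteCdf S a x = quoteCdf S a y) : y ∈ bestPenalties S a j := by
  have hgy : M.g j M.c ≤ y := hx.1.1.trans hxy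
  refine ⟨⟨hgy, hy⟩, fun z hz => ?_⟩
  have h1 : gain S a j x ≤ gain S a j y := by
    rw [gain, gain, h]
    refine mul_le_mul_of_nonneg_right ?_ (one_sub_w_quoteCdf_pos S a y).le
    linarith [f_le_f hj hjn (mem_image_g hj hjn hx.1.1 hx.1.2) (mem_image_g hj hjn hgy hy) hxy]
  exact le_trans (hx.2 hz) h1

variable {S : Fin M.l → M.Strategy} {i : Fin M.l}

theorem IsSymmetricNash.isCompact_bestPenalties (hS : M.IsSymmetricNash S) (hj : 1 ≤ j)
    (hjn : j ≤ M.n) : IsCompact (bestPenalties (S i) a j) := by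
  have hsub := Icc_c_f_v_subset (M := M) hj hjn
  have hg : ContinuousOn (M.g j) (Icc M.c (M.f j M.v)) := (M.g_continuous j hj hjn).mono hsub
  -- The gain is written in terms of the price, where continuity follows from that of `M.g j` alone.
  -- The maximizing prices form a compact set, and `M.g j` maps it onto the best penalties.
  set φ : ℝ → ℝ := fun p => (p - M.c) * (1 - M.w (quoteCdf (S i) a (M.g j p))) with hφ
  have hφc : ContinuousOn φ (Icc M.c (M.f j M.v)) := by
    refine ContinuousOn.mul (by fun_prop) (continuousOn_const.sub ?_)
    exact (M.continuous_w.comp (hS.continuous_quoteCdf i a)).comp_continuousOn hg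
  have hφg : ∀ p ∈ Icc M.c (M.f j M.v), gain (S i) a j (M.g j p) = φ p := by
    intro p hp
    rw [gain, f_g hj hjn (hsub hp)]
  have hcl : IsClosed (Icc M.c (M.f j M.v) ∩ φ ⁻¹'
      ⋂ y ∈ Icc (M.g j M.c) M.v, Ici (gain (S i) a j y)) :=
    hφc.preimage_isClosed_of_isClosed isClosed_Icc
      (isClosed_biInter fun _ _ => isClosed_Ici)
  have hcpt := (isCompact_Icc.of_isClosed_subset hcl inter_subset_left).image_of_continuousOn
    (hg.mono inter_subset_left)
  convert hcpt using 1
  ext x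
  constructor
  · rintro ⟨hx, hmax⟩
    rw [← image_g_Icc hj hjn] at hx
    obtain ⟨p, hp, rfl⟩ := hx
    refine ⟨p, ⟨hp, mem_iInter₂.2 fun y hy => ?_⟩, rfl⟩
    rw [mem_Ici, ← hφg p hp]
    exact hmax hy
  · rintro ⟨p, ⟨hp, hmax⟩, rfl⟩
    refine ⟨image_g_Icc (M := M) hj hjn ▸ mem_image_of_mem _ hp, fun y hy => ?_⟩
    have := mem_iInter₂.1 hmax y hy
    rw [mem_Ici, ← hφg p hp] at this
    exact this

theorem IsSymmetricNash.ae_mem_bestPenalties (hS : M.IsSymmetricNash S) (hj : 1 ≤ j)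
    (hjn : j ≤ M.n) (hα : 0 < M.nodeProb (S i) a j) :
    ∀ᵐ x ∂M.penaltyLaw (S i) a j, x ∈ bestPenalties (S i) a j := by
  obtain ⟨U, hU, hae⟩ := hS.exists_max_pos i a hj hjn hα
  filter_upwards [hae] with x ⟨hcx, hxv, hx⟩
  refine ⟨⟨hcx.le, hxv⟩, fun y hy => ?_⟩
  have := hU y (mem_image_g hj hjn hy.1 hy.2)
  rw [← hx, hS.winProb_eq_quoteCdf i a hxv, hS.winProb_eq_quoteCdf i a hy.2] at this
  exact this

/-- In a better state the best penalties are lower. -/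
theorem le_of_mem_bestPenalties {S : M.Strategy} (hj : 1 ≤ j) (hjk : j < k) (hk : k ≤ M.n)
    (hx : x ∈ bestPenalties S a j) (hy : y ∈ bestPenalties S a k) : y ≤ x := by
  by_contra! hxy
  have hjn : j ≤ M.n := hjk.le.trans hk
  have hk1 : 1 ≤ k := hj.trans hjk.le
  have hcx := g_c_lt_of_mem_bestPenalties hj hjn hx
  have hkj : M.g k M.c < M.g j M.c := M.g_lt j k hj hjk hk M.c M.c_mem
  have hyv : y ≤ M.v := hy.1.2
  have hxj : x ∈ M.g j '' M.prices := mem_image_g hj hjn hcx.le hx.1.2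
  have hxk : x ∈ M.g k '' M.prices := mem_image_g hk1 hk (hkj.trans hcx).le hx.1.2
  have hyj : y ∈ M.g j '' M.prices := mem_image_g hj hjn (hcx.trans hxy).le hyv
  have hyk : y ∈ M.g k '' M.prices := mem_image_g hk1 hk (hkj.trans (hcx.trans hxy)).le hyv
  have hA := sub_pos.2 ((c_lt_f_iff hj hjn hxj).2 hcx)
  have hB := sub_pos.2 ((c_lt_f_iff hk1 hk hxk).2 (hkj.trans hcx))
  have hA' := sub_pos.2 ((c_lt_f_iff hj hjn hyj).2 (hcx.trans hxy))
  have hB' := sub_pos.2 ((c_lt_f_iff hk1 hk hyk).2 (hkj.trans (hcx.trans hxy)))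
  have hr : (M.f j x - M.c) / (M.f k x - M.c) < (M.f j y - M.c) / (M.f k y - M.c) :=
    M.ratio_lt j k hj hjk hk y x hcx hxy hyj hyk
  rw [div_lt_div_iff₀ hB hB'] at hr
  have h1 : gain S a j y ≤ gain S a j x := hx.2 ⟨(hcx.trans hxy).le, hyv⟩
  have h2 : gain S a k x ≤ gain S a k y := hy.2 ⟨(hkj.trans hcx).le, hx.1.2⟩
  have hW := one_sub_w_quoteCdf_pos S a x
  have hW' := one_sub_w_quoteCdf_pos S a y
  rw [gain, gain] at h1 h2
  -- Multiplying the two optimality inequalities yields the reverse of `hr` times the product of the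
  -- win probabilities.
  have h3 := mul_le_mul h1 h2 (mul_pos hB hW).le (mul_pos hA hW).le
  have h4 := mul_lt_mul_of_pos_right hr (mul_pos hW hW')
  linarith

end Best

/-! ### Location of the penalty laws -/

theorem tailSum_eq_add {j : ℕ} (hjn : j ≤ M.n) (α : ℕ → ℝ) :
    M.tailSum α j = α j + M.tailSum α (j + 1) := by
  rw [tailSum, tailSum, ← Finset.add_sum_Ioc_eq_sum_Icc hjn, Finset.Icc_add_one_left_eq_Ioc]

theorem one_sub_w_tailSum_pos (S : M.Strategy) (a : V) {j : ℕ} (hj : 1 ≤ j) :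
    0 < 1 - M.w (M.tailSum (M.nodeProb S a) j) := by
  refine sub_pos.2 (M.w_lt_one (Finset.sum_nonneg fun k _ => M.nodeProb_nonneg S a k) ?_)
  refine lt_of_le_of_lt ?_ (M.sum_nodeProb_lt_one S a)
  exact Finset.sum_le_sum_of_subset_of_nonneg (Finset.Icc_subset_Icc_left hj)
    fun k _ _ => M.nodeProb_nonneg S a k

theorem quoteCdf_eq_tailSum_add {S : M.Strategy} {a : V} {j : ℕ} {x : ℝ} (hj : 1 ≤ j)
    (hjn : j ≤ M.n)
    (h1 : ∀ k, j < k → k ≤ M.n → 0 < M.nodeProb S a k → (M.penaltyLaw S a k).real (Iic x) = 1)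
    (h0 : ∀ k, 1 ≤ k → k < j → 0 < M.nodeProb S a k → (M.penaltyLaw S a k).real (Iic x) = 0) :
    quoteCdf S a x = M.tailSum (M.nodeProb S a) (j + 1) +
      M.nodeProb S a j * (M.penaltyLaw S a j).real (Iic x) := by
  have h2 : ∑ k ∈ Finset.Icc j M.n, M.nodeProb S a k * (M.penaltyLaw S a k).real (Iic x) =
      quoteCdf S a x := by
    rw [quoteCdf_eq_sum]
    refine Finset.sum_subset (Finset.Icc_subset_Icc_left hj) fun k hk hk' => ?_
    simp only [Finset.mem_Icc] at hk hk'
    rcases (M.nodeProb_nonneg S a k).eq_or_lt with h | h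
    · rw [← h, zero_mul]
    · rw [h0 k hk.1 (by omega) h, mul_zero]
  rw [← h2, ← Finset.add_sum_Ioc_eq_sum_Icc hjn, add_comm, add_left_inj]
  refine Finset.sum_congr (Finset.Icc_add_one_left_eq_Ioc ..).symm fun k hk => ?_
  have hk' := Finset.mem_Icc.1 hk
  rcases (M.nodeProb_nonneg S a k).eq_or_lt with h | h
  · rw [← h, zero_mul]
  · rw [h1 k hk'.1 hk'.2 h, mul_one]

theorem real_Iic_eq_one {ν : Measure ℝ} [IsProbabilityMeasure ν] {x : ℝ}
    (h : ∀ᵐ y ∂ν, y ≤ x) : ν.real (Iic x) = 1 := by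
  rw [measureReal_def, ENNReal.toReal_eq_one_iff]
  exact (prob_compl_eq_zero_iff measurableSet_Iic).1 h

theorem ae_le_of_real_Iic_eq_one {ν : Measure ℝ} [IsProbabilityMeasure ν] {x : ℝ}
    (h : ν.real (Iic x) = 1) : ∀ᵐ y ∂ν, y ≤ x := by
  rw [measureReal_def, ENNReal.toReal_eq_one_iff] at h
  exact (prob_compl_eq_zero_iff measurableSet_Iic).2 h

/-- The penalty laws lie on the correct sides of `x`: those of the states `k > j` below, those of
the states `k ≤ j` above. -/
structure Separates (S : M.Strategy) (a : V) (j : ℕ) (x : ℝ) : Prop where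
  le_v : x ≤ M.v
  g_c_lt : ∀ k, 1 ≤ k → j ≤ k → k ≤ M.n → M.g k M.c < x
  below : ∀ k, j < k → k ≤ M.n → 0 < M.nodeProb S a k → (M.penaltyLaw S a k).real (Iic x) = 1
  above : ∀ k, 1 ≤ k → k ≤ j → 0 < M.nodeProb S a k → (M.penaltyLaw S a k).real (Iic x) = 0

/-! ### Induction over the states: endpoints and distribution functions -/

section Step

variable {S : Fin M.l → M.Strategy} {i : Fin M.l} {a : V} {j : ℕ} {u x : ℝ}

theorem IsSymmetricNash.penaltyLaw_singleton (hS : M.IsSymmetricNash S) (hj : 1 ≤ j)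
    (hjn : j ≤ M.n) (hα : 0 < M.nodeProb (S i) a j) (x : ℝ) :
    (M.penaltyLaw (S i) a j) {x} = 0 := by
  have h := hS.offerLaw_real_singleton i a x
  have hpre : Real.toEReal ⁻¹' {(x : EReal)} = {x} := by
    ext y
    simp
  rw [offerLaw_real_eq_sum_penaltyLaw (measurableSet_singleton _) (by simp), hpre,
    Finset.sum_eq_zero_iff_of_nonneg fun k _ =>
      mul_nonneg (M.nodeProb_nonneg _ a k) measureReal_nonneg] at h
  have := isProbabilityMeasure_penaltyLaw hα
  have h2 := (mul_eq_zero.1 (h j (Finset.mem_Icc.2 ⟨hj, hjn⟩))).resolve_left hα.ne'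
  rwa [measureReal_eq_zero_iff] at h2

theorem IsSymmetricNash.separates_v (hS : M.IsSymmetricNash S) : Separates (S i) a 0 M.v where
  le_v := le_rfl
  g_c_lt k hk _ hkn := M.g_c_lt_v k hk hkn
  below k hk hkn hα := by
    have := isProbabilityMeasure_penaltyLaw hα
    refine real_Iic_eq_one ?_
    filter_upwards [hS.ae_mem_bestPenalties hk hkn hα] with x hx
    exact hx.1.2
  above k h1 h2 := by omega

/-- Let `s` be the largest best penalty that is at most `u`. No state puts mass in (s, u]: state `j
+ 1` by maximality of `s`, better states by the ordering, worse states by separation. So F is flat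
there and `u` is optimal as well. -/
theorem Separates.mem_bestPenalties (h : Separates (S i) a j u) (hS : M.IsSymmetricNash S)
    (hjn : j + 1 ≤ M.n) (hα : 0 < M.nodeProb (S i) a (j + 1)) :
    u ∈ bestPenalties (S i) a (j + 1) := by
  have hj : 1 ≤ j + 1 := by omega
  have hprob := isProbabilityMeasure_penaltyLaw hα
  have hae : ∀ᵐ y ∂M.penaltyLaw (S i) a (j + 1), y ∈ bestPenalties (S i) a (j + 1) ∩ Iic u := by
    filter_upwards [hS.ae_mem_bestPenalties hj hjn hα,
      ae_le_of_real_Iic_eq_one (h.below (j + 1) (by omega) hjn hα)] with y h1 h2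
    exact ⟨h1, h2⟩
  obtain ⟨s, ⟨hs, hsu⟩, hmax⟩ := ((hS.isCompact_bestPenalties (i := i) (a := a) hj hjn).inter_right
    isClosed_Iic).exists_isGreatest hae.exists
  refine mem_bestPenalties_of_quoteCdf_eq hj hjn hs hsu h.le_v ?_
  have h1 : (M.penaltyLaw (S i) a (j + 1)).real (Iic s) = 1 :=
    real_Iic_eq_one (hae.mono fun y hy => hmax hy)
  rw [quoteCdf_eq_tailSum_add hj hjn (x := s), quoteCdf_eq_tailSum_add hj hjn (x := u), h1,
    h.below (j + 1) (by omega) hjn hα]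
  · exact fun k hk hkn hαk => h.below k (by omega) hkn hαk
  · exact fun k hk hkj hαk => h.above k hk (by omega) hαk
  · intro k hk hkn hαk
    have := isProbabilityMeasure_penaltyLaw hαk
    refine real_Iic_eq_one ?_
    filter_upwards [hS.ae_mem_bestPenalties (by omega) hkn hαk] with y hy
    exact le_of_mem_bestPenalties hj hk hkn hs hy
  · intro k hk hkj hαk
    have := isProbabilityMeasure_penaltyLaw hαk
    refine le_antisymm ?_ measureReal_nonneg
    rw [← h.above k hk (by omega) hαk]
    exact measureReal_mono (Iic_subset_Iic.2 hsu)

theorem Separates.quoteCdf_eq (h : Separates (S i) a j u) (hjn : j + 1 ≤ M.n)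
    (hα : 0 < M.nodeProb (S i) a (j + 1)) :
    quoteCdf (S i) a u = M.tailSum (M.nodeProb (S i) a) (j + 1) := by
  rw [quoteCdf_eq_tailSum_add (by omega) hjn
    (fun k hk hkn hαk => h.below k (by omega) hkn hαk)
    (fun k hk hkj hαk => h.above k hk (by omega) hαk), h.below (j + 1) (by omega) hjn hα,
    tailSum_eq_add hjn]
  ring

/-- The least best penalty `t` is the next separating point; absence of atoms keeps state `j + 1`
from charging `t`. Both `t` and `u` being optimal, their gains agree. -/
theorem Separates.step (h : Separates (S i) a j u) (hS : M.IsSymmetricNash S)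
    (hjn : j + 1 ≤ M.n) (hα : 0 < M.nodeProb (S i) a (j + 1)) :
    ∃ t, IsLeast (bestPenalties (S i) a (j + 1)) t ∧ Separates (S i) a (j + 1) t ∧
      gain (S i) a (j + 1) t = M.profit (M.nodeProb (S i) a) (j + 1) u ∧
      quoteCdf (S i) a t = M.tailSum (M.nodeProb (S i) a) (j + 2) := by
  have hj : 1 ≤ j + 1 := by omega
  have hprob := isProbabilityMeasure_penaltyLaw hα
  have hu := h.mem_bestPenalties hS hjn hα
  obtain ⟨t, ht⟩ := (hS.isCompact_bestPenalties (i := i) (a := a) hj hjn).exists_isLeast ⟨u, hu⟩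
  have htu : t ≤ u := ht.2 hu
  have hgt := g_c_lt_of_mem_bestPenalties hj hjn ht.1
  have hsep : Separates (S i) a (j + 1) t := by
    refine ⟨ht.1.1.2, fun k hk hjk hkn => ?_, fun k hk hkn hαk => ?_, fun k hk hkj hαk => ?_⟩
    · rcases hjk.eq_or_lt with rfl | hlt
      · exact hgt
      · exact (M.g_lt _ k hj hlt hkn _ M.c_mem).trans hgt
    · have := isProbabilityMeasure_penaltyLaw hαk
      refine real_Iic_eq_one ?_
      filter_upwards [hS.ae_mem_bestPenalties (by omega) hkn hαk] with y hy
      exact le_of_mem_bestPenalties hj hk hkn ht.1 hy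
    · have := isProbabilityMeasure_penaltyLaw hαk
      rcases hkj.eq_or_lt with rfl | hlt
      · rw [measureReal_eq_zero_iff]
        have h0 : ∀ᵐ y ∂M.penaltyLaw (S i) a (j + 1), y ≠ t := by
          rw [ae_iff]
          simpa using hS.penaltyLaw_singleton hj hjn hα t
        have h2 : ∀ᵐ y ∂M.penaltyLaw (S i) a (j + 1), y ∉ Iic t := by
          filter_upwards [hS.ae_mem_bestPenalties hj hjn hα, h0] with y hy hne
          exact not_le.2 (lt_of_le_of_ne (ht.2 hy) hne.symm)
        exact measure_eq_zero_iff_ae_notMem.2 h2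
      · refine le_antisymm ?_ measureReal_nonneg
        rw [← h.above k hk (by omega) hαk]
        exact measureReal_mono (Iic_subset_Iic.2 htu)
  refine ⟨t, ht, hsep, ?_, ?_⟩
  · have : gain (S i) a (j + 1) t = gain (S i) a (j + 1) u :=
      le_antisymm (hu.2 ht.1.1) (ht.1.2 hu.1)
    rw [this, gain, h.quoteCdf_eq hjn hα, profit]
  · rw [quoteCdf_eq_tailSum_add hj hjn hsep.below
      (fun k hk hkj hαk => hsep.above k hk hkj.le hαk), hsep.above (j + 1) hj le_rfl hα,
      mul_zero, add_zero]

theorem Separates.isLeast_L (h : Separates (S i) a j (M.L (M.nodeProb (S i) a) j))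
    (hS : M.IsSymmetricNash S) (hjn : j + 1 ≤ M.n) (hα : 0 < M.nodeProb (S i) a (j + 1)) :
    IsLeast (bestPenalties (S i) a (j + 1)) (M.L (M.nodeProb (S i) a) (j + 1)) ∧
      Separates (S i) a (j + 1) (M.L (M.nodeProb (S i) a) (j + 1)) := by
  obtain ⟨t, ht, hsep, hgain, hF⟩ := h.step hS hjn hα
  have htm : t ∈ M.g (j + 1) '' M.prices :=
    mem_image_g (by omega) hjn ht.1.1.1 ht.1.1.2
  -- The gain at `t` is (f(t) - c) times the factor that the definition of `L` divides by, so that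
  -- definition returns `t`.
  have hL : M.L (M.nodeProb (S i) a) (j + 1) = t := by
    rw [L, ← hgain, gain, hF, mul_div_cancel_right₀ _
      (one_sub_w_tailSum_pos (S i) a (by omega)).ne', sub_add_cancel, g_f htm]
  rw [hL]
  exact ⟨ht, hsep⟩

theorem IsSymmetricNash.separates_L (hS : M.IsSymmetricNash S) (i : Fin M.l) (a : V) {j : ℕ}
    (hjn : j ≤ M.n) : Separates (S i) a j (M.L (M.nodeProb (S i) a) j) := by
  induction j with
  | zero => exact hS.separates_v
  | succ j ih =>
    have h := ih (by omega)
    rcases (M.nodeProb_nonneg (S i) a (j + 1)).eq_or_lt with hα | hα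
    · have hT : M.tailSum (M.nodeProb (S i) a) (j + 1) =
          M.tailSum (M.nodeProb (S i) a) (j + 2) := by
        rw [tailSum_eq_add hjn, ← hα, zero_add]
      -- With zero weight there is no optimality to use; the field `g_c_lt` guarantees that the old
      -- endpoint can still be inverted in this state, and so `L` does not move.
      have hm : M.L (M.nodeProb (S i) a) j ∈ M.g (j + 1) '' M.prices :=
        mem_image_g (by omega) hjn (h.g_c_lt (j + 1) (by omega) (by omega) hjn).le h.le_v
      have hL : M.L (M.nodeProb (S i) a) (j + 1) = M.L (M.nodeProb (S i) a) j := by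
        rw [L, profit, hT, mul_div_cancel_right₀ _
          (one_sub_w_tailSum_pos (S i) a (by omega)).ne', sub_add_cancel, g_f hm]
      rw [hL]
      refine ⟨h.le_v, fun k hk hjk hkn => h.g_c_lt k hk (by omega) hkn,
        fun k hk hkn hαk => h.below k (by omega) hkn hαk, fun k hk hkj hαk => ?_⟩
      rcases hkj.eq_or_lt with rfl | hlt
      · exact absurd hα hαk.ne
      · exact h.above k hk (by omega) hαk
    · exact (h.isLeast_L hS hjn hα).2

theorem IsSymmetricNash.mem_bestPenalties_of_mem_Icc (hS : M.IsSymmetricNash S)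
    (hjn : j + 1 ≤ M.n) (hα : 0 < M.nodeProb (S i) a (j + 1))
    (hx : x ∈ Icc (M.L (M.nodeProb (S i) a) (j + 1)) (M.L (M.nodeProb (S i) a) j)) :
    x ∈ bestPenalties (S i) a (j + 1) ∧
      quoteCdf (S i) a x = M.tailSum (M.nodeProb (S i) a) (j + 2) +
        M.nodeProb (S i) a (j + 1) * (M.penaltyLaw (S i) a (j + 1)).real (Iic x) := by
  have hj : 1 ≤ j + 1 := by omega
  have hprob := isProbabilityMeasure_penaltyLaw hα
  have h := hS.separates_L i a (j := j) (by omega)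
  obtain ⟨hleast, hsep⟩ := h.isLeast_L hS hjn hα
  have key : ∀ z ∈ Icc (M.L (M.nodeProb (S i) a) (j + 1)) (M.L (M.nodeProb (S i) a) j),
      quoteCdf (S i) a z = M.tailSum (M.nodeProb (S i) a) (j + 2) +
        M.nodeProb (S i) a (j + 1) * (M.penaltyLaw (S i) a (j + 1)).real (Iic z) := by
    intro z hz
    refine quoteCdf_eq_tailSum_add hj hjn (fun k hk hkn hαk => ?_) fun k hk hkj hαk => ?_
    · have := isProbabilityMeasure_penaltyLaw hαk
      refine le_antisymm measureReal_le_one ?_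
      rw [← hsep.below k hk hkn hαk]
      exact measureReal_mono (Iic_subset_Iic.2 hz.1)
    · have := isProbabilityMeasure_penaltyLaw hαk
      refine le_antisymm ?_ measureReal_nonneg
      rw [← h.above k hk (by omega) hαk]
      exact measureReal_mono (Iic_subset_Iic.2 hz.2)
  refine ⟨?_, key x hx⟩
  -- The no-gap argument inside the interval: past the largest best penalty `s` ≤ `x`, state `j + 1`
  -- has no mass up to `x`, and it is the only state that moves F here.
  obtain ⟨s, ⟨hs, hsx⟩, hmax⟩ := ((hS.isCompact_bestPenalties (i := i) (a := a) hj hjn).inter_right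
    isClosed_Iic).exists_isGreatest ⟨_, hleast.1, hx.1⟩
  refine mem_bestPenalties_of_quoteCdf_eq hj hjn hs hsx (hx.2.trans h.le_v) ?_
  rw [key x hx, key s ⟨hleast.2 hs, le_trans hsx hx.2⟩]
  congr 2
  refine measureReal_congr ?_
  filter_upwards [hS.ae_mem_bestPenalties hj hjn hα] with y hy
  exact propext ⟨fun hys => le_trans hys hsx, fun hyx => hmax ⟨hy, hyx⟩⟩

theorem IsSymmetricNash.penaltyLaw_real_Iic (hS : M.IsSymmetricNash S) (hj : 1 ≤ j)
    (hjn : j ≤ M.n) (hα : 0 < M.nodeProb (S i) a j) (x : ℝ) :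
    (M.penaltyLaw (S i) a j).real (Iic x) = M.phi (M.nodeProb (S i) a) j x := by
  obtain ⟨j, rfl⟩ : ∃ k, j = k + 1 := ⟨j - 1, by omega⟩
  have hprob := isProbabilityMeasure_penaltyLaw hα
  have h := hS.separates_L i a (j := j) (by omega)
  obtain ⟨hleast, hsep⟩ := h.isLeast_L hS hjn hα
  rw [phi, Nat.add_sub_cancel]
  split_ifs with h1 h2
  · refine le_antisymm ?_ measureReal_nonneg
    rw [← hsep.above (j + 1) hj le_rfl hα]
    exact measureReal_mono (Iic_subset_Iic.2 h1.le)
  · obtain ⟨hx, hF⟩ := hS.mem_bestPenalties_of_mem_Icc hjn hα ⟨not_lt.1 h1, h2⟩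
    have hu := h.mem_bestPenalties hS hjn hα
    have hgain : gain (S i) a (j + 1) x =
        M.profit (M.nodeProb (S i) a) (j + 1) (M.L (M.nodeProb (S i) a) j) := by
      have : gain (S i) a (j + 1) x = gain (S i) a (j + 1) (M.L (M.nodeProb (S i) a) j) :=
        le_antisymm (hu.2 hx.1) (hx.2 hu.1)
      rw [this, gain, h.quoteCdf_eq hjn hα, profit]
    have hpos : 0 < M.f (j + 1) x - M.c :=
      sub_pos.2 ((c_lt_f_iff hj hjn (mem_image_g hj hjn hx.1.1 hx.1.2)).2
        (g_c_lt_of_mem_bestPenalties hj hjn hx))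
    -- The constant gain equals p - c, so 1 - w(F(x)) = (p - c)/(f(x) - c), which rearranges to the
    -- argument of `wInv` in `phi`.
    have hw : (M.f (j + 1) x - M.p (M.nodeProb (S i) a) (j + 1)) / (M.f (j + 1) x - M.c) =
        M.w (quoteCdf (S i) a x) := by
      rw [div_eq_iff hpos.ne', p, Nat.add_sub_cancel, ← hgain, gain]
      ring
    rw [hw, M.wInv_w (quoteCdf_mem_Icc (S i) a x), hF]
    field_simp
    ring
  · refine le_antisymm measureReal_le_one ?_
    rw [← h.below (j + 1) (by omega) hjn hα]
    exact measureReal_mono (Iic_subset_Iic.2 (not_le.1 h2).le)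

end Step

/-- The penalty law is a weighted average, and state vectors of zero weight drop out, so agreement
is needed only where the weight is positive. -/
theorem penaltyLaw_real_eq_of_forall_eq {S : M.Strategy} {a : V} {j : ℕ}
    (hα : 0 < M.nodeProb S a j) {ν : Measure ℝ}
    (hν : ∀ J : V → Fin (M.n + 1), (J a : ℕ) = j → 0 < M.q J → 0 < (S J).offerProb a →
      (S J).penalty a = ν) (s : Set ℝ) : (M.penaltyLaw S a j).real s = ν.real s := by
  have h : ∀ J ∈ Finset.univ.filter (fun J : V → Fin (M.n + 1) => (J a : ℕ) = j),
      M.q J * (S J).offerProb a * ((S J).penalty a).real s =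
        M.q J * (S J).offerProb a * ν.real s := by
    intro J hJ
    rcases (M.q_nonneg J).eq_or_lt with hq | hq
    · rw [← hq, zero_mul, zero_mul, zero_mul]
    rcases ((S J).offerProb_nonneg a).eq_or_lt with ho | ho
    · rw [← ho, mul_zero, zero_mul, zero_mul]
    rw [hν J (Finset.mem_filter.1 hJ).2 hq ho]
  rw [penaltyLaw_real, Finset.sum_congr rfl h, ← Finset.sum_mul]
  exact inv_mul_cancel_left₀ hα.ne' _

end SpectrumMarket

theorem mainTheorem6 {V : Type*} [Fintype V] [DecidableEq V] (M : SpectrumMarket V)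
    (S : Fin M.l → M.Strategy) (hS : M.IsSymmetricNash S)
    (i : Fin M.l) (a : V) (j : ℕ) (hj : 1 ≤ j) (hjn : j ≤ M.n)
    (hα : 0 < M.nodeProb (S i) a j) :
    (∀ x : ℝ, (M.penaltyLaw (S i) a j).real (Set.Iic x) = M.phi (M.nodeProb (S i) a) j x) ∧
    -- If the strategy quotes at `a` one and the same law `ν` in state `j`, then `ν` is that law.
    (∀ ν : MeasureTheory.Measure ℝ,
      (∀ J : V → Fin (M.n + 1), (J a : ℕ) = j → 0 < M.q J → 0 < (S i J).offerProb a →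
        (S i J).penalty a = ν) →
      ∀ x : ℝ, ν.real (Set.Iic x) = M.phi (M.nodeProb (S i) a) j x) := by
  refine ⟨hS.penaltyLaw_real_Iic hj hjn hα, fun ν hν x => ?_⟩
  rw [← SpectrumMarket.penaltyLaw_real_eq_of_forall_eq hα hν]
  exact hS.penaltyLaw_real_Iic hj hjn hα x
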